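/- Write $f(t)\asymp g(t)$ as $t\to\infty$ if $\lim_{t\to\infty} f(t)/g(t)=c$ for some constant $c>0$. A non-negative $n\times n$ matrix is primitive if some power of it with exponent $k\ge 1$ has only positive entries; $\rho(\cdot)$ denotes the spectral radius, $\mathbf e_1,\dots,\mathbf e_n$ are the standard basis row vectors of $\mathbb R^n$, and $\|\mathbf x\|_1$ is the sum of the entries of $\mathbf x$. Let $\mathbf X_1,\dots,\mathbf X_m$ be primitive $n\times n$ matrices with (non-negative) integer entries, let $p_1,\dots,p_m>0$ with $p_1+\dots+p_m=1$, and set $\overline{\mathbf X}=p_1\mathbf X_1+\dots+p_m\mathbf X_m$. Let $T'_{t,k}(\mathbf e_i)$, for integers $t\ge 0$, $k\ge 0$ and $1\le i\le n$, be mutually independent random vectors on a probability space such that $T'_{t,k}(\mathbf e_i)$ has law $\sum_{j=1}^m p_j\,\delta_{\mathbf e_i\mathbf X_j}$, that is, it equals $\mathbf e_i\mathbf X_j$ with probability $p_j$. Let $\boldsymbol\alpha_0\in\{0,1,2,\dots\}^n$ be a fixed non-zero vector, and define recursively $$\boldsymbol\alpha_{t+1}=\sum_{i=1}^n\ \sum_{k=0}^{[\boldsymbol\alpha_t]_i-1}T'_{t,k}(\mathbf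 e_i),\qquad t\ge 0,$$ so that in each step every copy of every basis vector is replaced independently. Let $\xi_t=\|\boldsymbol\alpha_t\|_1$ be the resulting stochastic substitution process. If $\overline{\mathbf X}$ is invertible, then $$\Pr\bigl(\xi_t\asymp\rho(\overline{\mathbf X})^t \text{ as } t\to\infty\bigr)=1,$$ that is, almost surely $\xi_t/\rho(\overline{\mathbf X})^t$ converges to a positive finite limit (which may depend on the realization). -/

import Mathlib

open MeasureTheory ProbabilityTheory Filter Topology

noncomputable section

/-- `ρ(A)`: the largest modulus of a complex eigenvalue of the real square matrix `A`. -/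
def matrixSpectralRadius {n : ℕ} (A : Matrix (Fin n) (Fin n) ℝ) : ℝ :=
  (spectralRadius ℂ (A.map (algebraMap ℝ ℂ))).toReal

/-- `f t ≍ g t` as `t → ∞`: the quotient `f t / g t` converges to some constant `c > 0`. -/
def AsympConst (f g : ℕ → ℝ) : Prop :=
  ∃ c : ℝ, 0 < c ∧ Tendsto (fun t => f t / g t) atTop (𝓝 c)

/-- The mean matrix `p₁ X₁ + ⋯ + pₘ Xₘ`. -/
def meanMatrix {n m : ℕ} (X : Fin m → Matrix (Fin n) (Fin n) ℕ) (p : Fin m → ℝ) :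
    Matrix (Fin n) (Fin n) ℝ :=
  ∑ j, p j • (X j).map (Nat.cast : ℕ → ℝ)

/-- The law of the random vector replacing `e_i`: it equals `e_i X_j`, the `i`-th row of `X j`,
with probability `p j`. -/
def replacementLaw {n m : ℕ} (X : Fin m → Matrix (Fin n) (Fin n) ℕ) (p : Fin m → ℝ)
    (i : Fin n) : Measure (Fin n → ℕ) :=
  ∑ j, ENNReal.ofReal (p j) • Measure.dirac (X j i)

/-- The random vectors driving the process: `R t i k` replaces the `k`-th copy of `e_i` in the
step from time `t` to time `t + 1`. They are all mutually independent, and each `R t i k` is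
distributed as the replacement of `e_i`. -/
structure IsReplacementFamily {Ω : Type*} [MeasurableSpace Ω] (P : Measure Ω) {n m : ℕ}
    (X : Fin m → Matrix (Fin n) (Fin n) ℕ) (p : Fin m → ℝ)
    (R : ℕ → Fin n → ℕ → Ω → (Fin n → ℕ)) : Prop where
  hasLaw : ∀ t i k, HasLaw (R t i k) (replacementLaw X p i) P
  indep : iIndepFun (fun (a : ℕ × Fin n × ℕ) => R a.1 a.2.1 a.2.2) P

/-- One substitution step: for each `i`, the `x i` copies of `e_i` in `x = ∑ i, x i • e_i` are
replaced by the vectors `r i 0, …, r i (x i - 1)`, and everything is added up. -/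
def substitute {n : ℕ} (r : Fin n → ℕ → (Fin n → ℕ)) (x : Fin n → ℕ) : Fin n → ℕ :=
  ∑ i, ∑ k ∈ Finset.range (x i), r i k

/-- The random vectors `α_t`, with `α_t = T_t (α_{t-1})`, started from `α₀`. -/
def substitutionVector {Ω : Type*} {n : ℕ} (R : ℕ → Fin n → ℕ → Ω → (Fin n → ℕ))
    (α₀ : Fin n → ℕ) : ℕ → Ω → (Fin n → ℕ)
  | 0, _ => α₀
  | t + 1, ω => substitute (fun i k => R t i k ω) (substitutionVector R α₀ t ω)

/-- The stochastic substitution process `ξ_t = ‖α_t‖₁`, the sum of the entries of `α_t`. -/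
def substitutionProcess {Ω : Type*} {n : ℕ} (R : ℕ → Fin n → ℕ → Ω → (Fin n → ℕ))
    (α₀ : Fin n → ℕ) (t : ℕ) (ω : Ω) : ℝ :=
  ∑ i, (substitutionVector R α₀ t ω i : ℝ)

end

/-! Let `A` be the mean matrix, with Perron eigenvalue `r` and positive right and left eigenvectors
`v`, `u`; by `matrixSpectralRadius_eq`, `r` is its spectral radius. Given the past, the mean of
`α_{t+1}` is `α_t A`. Hence `y_t = α_t / r^t` is an orbit of `A / r` perturbed by a normalized noise
`ε_t`.

Given the past, the noise is a sum of independent, bounded, centered terms, one per individual. Its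
variance is at most linear in the population, so of order `r^t` in mean. After normalization `ε_t`
has size about `r^(-t/2)`, so it is almost surely summable when `r > 1` (`ae_summable_noise`). The
rest of the convergence is deterministic (`tendsto_of_perturbed_orbit`): `y_t ⬝ᵥ v` has summable
increments, and the component transversal to `u` is contracted by a power of `A / r`. Thus `y_t`
tends to a multiple of `u`, fixed by `W = lim y_t ⬝ᵥ v`.

It remains to exclude `W = 0`. Primitive integer matrices have no zero row, so the population never
dies out. A one-sided Chebyshev estimate, uniform in the past, bounds the conditional probability of
`W = 0` by a constant below `1` (`exists_measureReal_tendsto_zero_inter_le`), and Lévy's zero-one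
law makes the event null (`measure_eq_zero_of_forall_inter_le`).

Integer entries also give `r ≥ 1`. If `r = 1`, all row sums equal `1` and the population is
constant. -/

/-- A positive function on a finite type is bounded below by a positive constant. -/
lemma exists_pos_forall_le {ι : Type*} [Finite ι] (f : ι → ℝ) (hf : ∀ i, 0 < f i) :
    ∃ ε : ℝ, 0 < ε ∧ ∀ i, ε ≤ f i := by
  rcases isEmpty_or_nonempty ι with h | h
  · exact ⟨1, one_pos, fun i => h.elim i⟩
  · obtain ⟨i, hi⟩ := Finite.exists_min f
    exact ⟨f i, hf i, hi⟩

/-! ### Perron eigenvectors of primitive matrices. -/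

section Perron

open Matrix

variable {ι : Type*} [Fintype ι]

lemma mulVec_nonneg_of_nonneg {A : Matrix ι ι ℝ} (hA : ∀ i j, 0 ≤ A i j) {x : ι → ℝ}
    (hx : ∀ i, 0 ≤ x i) (i : ι) : 0 ≤ (A *ᵥ x) i :=
  Finset.sum_nonneg fun j _ => mul_nonneg (hA i j) (hx j)

lemma mulVec_pos_of_pos {A : Matrix ι ι ℝ} (hA : ∀ i j, 0 < A i j) {x : ι → ℝ}
    (hx : ∀ i, 0 ≤ x i) (hx0 : x ≠ 0) (i : ι) : 0 < (A *ᵥ x) i := by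
  obtain ⟨j, hj⟩ := Function.ne_iff.1 hx0
  exact Finset.sum_pos' (fun j _ => mul_nonneg (hA i j).le (hx j))
    ⟨j, Finset.mem_univ j, mul_pos (hA i j) (lt_of_le_of_ne (hx j) (Ne.symm hj))⟩

/-- The Collatz–Wielandt maximum is attained on the simplex. -/
lemma exists_collatz_wielandt_max [Nonempty ι] {A : Matrix ι ι ℝ} (hA : ∀ i j, 0 ≤ A i j) :
    ∃ r : ℝ, ∃ x ∈ stdSimplex ℝ ι, 0 ≤ r ∧ (∀ i, r * x i ≤ (A *ᵥ x) i) ∧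
      ∀ s : ℝ, 0 ≤ s → ∀ y ∈ stdSimplex ℝ ι, (∀ i, s * y i ≤ (A *ᵥ y) i) → s ≤ r := by
  classical
  -- Summing `s * y i ≤ (A *ᵥ y) i` over the simplex bounds `s` by the sum of all entries; this
  -- makes the set of admissible pairs compact.
  set C : ℝ := ∑ i, ∑ j, A i j
  have hbound : ∀ s : ℝ, ∀ y ∈ stdSimplex ℝ ι, (∀ i, s * y i ≤ (A *ᵥ y) i) → s ≤ C := by
    intro s y hy h
    calc s = ∑ i, s * y i := by rw [← Finset.mul_sum, hy.2, mul_one]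
      _ ≤ ∑ i, (A *ᵥ y) i := Finset.sum_le_sum fun i _ => h i
      _ ≤ C := Finset.sum_le_sum fun i _ => Finset.sum_le_sum fun j _ => by
        have : y j ≤ 1 := hy.2 ▸ Finset.single_le_sum (fun k _ => hy.1 k) (Finset.mem_univ j)
        nlinarith [hA i j]
  let S : Set ((ι → ℝ) × ℝ) :=
    (stdSimplex ℝ ι ×ˢ Set.Icc 0 C) ∩ {z | ∀ i, z.2 * z.1 i ≤ (A *ᵥ z.1) i}
  have hclosed : IsClosed {z : (ι → ℝ) × ℝ | ∀ i, z.2 * z.1 i ≤ (A *ᵥ z.1) i} := by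
    simp only [Set.ofPred_forall, mulVec, dotProduct]
    exact isClosed_iInter fun i => isClosed_le (by fun_prop) (by fun_prop)
  have hS : IsCompact S := ((isCompact_stdSimplex ℝ ι).prod isCompact_Icc).inter_right hclosed
  have hC : 0 ≤ C := Finset.sum_nonneg fun i _ => Finset.sum_nonneg fun j _ => hA i j
  have hne : S.Nonempty := by
    obtain ⟨i⟩ := ‹Nonempty ι›
    refine ⟨(Pi.single i 1, 0), ⟨single_mem_stdSimplex ℝ i, le_rfl, hC⟩, fun j => ?_⟩
    simpa using mulVec_nonneg_of_nonneg hA (single_mem_stdSimplex ℝ i).1 j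
  obtain ⟨⟨x, r⟩, hz, hmax⟩ := hS.exists_isMaxOn hne continuous_snd.continuousOn
  refine ⟨r, x, hz.1.1, hz.1.2.1, hz.2, fun s hs y hy h => ?_⟩
  exact hmax (a := (y, s)) ⟨⟨hy, hs, hbound s y hy h⟩, h⟩

lemma pow_mulVec_of_eigen [DecidableEq ι] {A : Matrix ι ι ℝ} {v : ι → ℝ} {r : ℝ}
    (h : A *ᵥ v = r • v) (k : ℕ) : (A ^ k) *ᵥ v = r ^ k • v := by
  induction k with
  | zero => simp
  | succ k ih => rw [pow_succ, ← mulVec_mulVec, h, mulVec_smul, ih, smul_smul, pow_succ']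

/-- A primitive matrix has a positive eigenvector for a positive eigenvalue. -/
lemma Matrix.IsPrimitive.exists_pos_eigenvector [DecidableEq ι] [Nonempty ι] {A : Matrix ι ι ℝ}
    (hA : A.IsPrimitive) :
    ∃ r : ℝ, ∃ v : ι → ℝ, 0 < r ∧ (∀ i, 0 < v i) ∧ A *ᵥ v = r • v := by
  obtain ⟨k, hk, hpos⟩ := hA.exists_pos_pow
  obtain ⟨r, x, hx, hr, hrx, hmax⟩ := exists_collatz_wielandt_max hA.nonneg
  have hx0 : x ≠ 0 := by
    rintro rfl
    simpa using hx.2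
  have hy : ∀ i, 0 < ((A ^ k) *ᵥ x) i := mulVec_pos_of_pos hpos hx.1 hx0
  have heig : A *ᵥ x = r • x := by
    by_contra hne
    -- The slack `A *ᵥ x - r • x` is nonnegative and nonzero, so `A ^ k` makes it strictly positive.
    -- Then `A ^ k *ᵥ x`, once normalized, admits the larger value `r + ε`, against maximality.
    have hd : ∀ i, 0 < ((A ^ k) *ᵥ (A *ᵥ x - r • x)) i :=
      mulVec_pos_of_pos hpos (fun i => by simpa using hrx i) (sub_ne_zero.2 hne)
    obtain ⟨ε, hε, hεle⟩ := exists_pos_forall_le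
      (fun i => ((A ^ k) *ᵥ (A *ᵥ x - r • x)) i / ((A ^ k) *ᵥ x) i) fun i => div_pos (hd i) (hy i)
    set y := (A ^ k) *ᵥ x with hy_def
    have hs : 0 < ∑ i, y i := Finset.sum_pos (fun i _ => hy i) Finset.univ_nonempty
    have hcomm : (A ^ k) *ᵥ (A *ᵥ x - r • x) = A *ᵥ y - r • y := by
      rw [mulVec_sub, mulVec_smul, hy_def, mulVec_mulVec, mulVec_mulVec, ← pow_succ, ← pow_succ']
    have := hmax (r + ε) (by positivity) ((∑ i, y i)⁻¹ • y)
      ⟨fun i => mul_nonneg (inv_nonneg.2 hs.le) (hy i).le, by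
        simp only [Pi.smul_apply, smul_eq_mul, ← Finset.mul_sum]
        exact inv_mul_cancel₀ hs.ne'⟩ fun i => by
          have h1 := (le_div_iff₀ (hy i)).1 (hεle i)
          rw [hcomm] at h1
          simp only [Pi.sub_apply, Pi.smul_apply, smul_eq_mul] at h1
          simp only [mulVec_smul, Pi.smul_apply, smul_eq_mul]
          have := mul_le_mul_of_nonneg_left (show (r + ε) * y i ≤ (A *ᵥ y) i by linarith)
            (inv_nonneg.2 hs.le)
          linarith
    linarith
  have hpow := pow_mulVec_of_eigen heig k
  have hv : ∀ i, 0 < r ^ k * x i := fun i => by simpa [hpow] using hy i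
  have hr0 : r ≠ 0 := by
    rintro rfl
    obtain ⟨i⟩ := ‹Nonempty ι›
    simpa [zero_pow hk.ne'] using hv i
  exact ⟨r, x, lt_of_le_of_ne hr hr0.symm,
    fun i => pos_of_mul_pos_right (hv i) (pow_nonneg hr k), heig⟩

lemma Matrix.IsPrimitive.transpose [DecidableEq ι] {A : Matrix ι ι ℝ} (hA : A.IsPrimitive) :
    Aᵀ.IsPrimitive where
  nonneg i j := hA.nonneg j i
  exists_pos_pow := by
    obtain ⟨k, hk, h⟩ := hA.exists_pos_pow
    exact ⟨k, hk, fun i j => by simpa [← transpose_pow] using h j i⟩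

lemma dotProduct_pos [Nonempty ι] {u v : ι → ℝ} (hu : ∀ i, 0 < u i) (hv : ∀ i, 0 < v i) :
    0 < u ⬝ᵥ v :=
  Finset.sum_pos (fun i _ => mul_pos (hu i) (hv i)) Finset.univ_nonempty

/-- Positive right and left eigenvectors of a primitive matrix for a common eigenvalue. -/
lemma Matrix.IsPrimitive.exists_pos_eigenvectors [DecidableEq ι] [Nonempty ι] {A : Matrix ι ι ℝ}
    (hA : A.IsPrimitive) :
    ∃ r : ℝ, ∃ v u : ι → ℝ, 0 < r ∧ (∀ i, 0 < v i) ∧ (∀ i, 0 < u i) ∧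
      A *ᵥ v = r • v ∧ u ᵥ* A = r • u := by
  obtain ⟨r, v, hr, hv, hrv⟩ := hA.exists_pos_eigenvector
  obtain ⟨s, u, hs, hu, hsu⟩ := hA.transpose.exists_pos_eigenvector
  rw [mulVec_transpose] at hsu
  -- Evaluating `u A v` in both ways identifies the two eigenvalues, since `u ⬝ᵥ v > 0`.
  have h1 : u ⬝ᵥ (A *ᵥ v) = (u ᵥ* A) ⬝ᵥ v := dotProduct_mulVec u A v
  rw [hrv, hsu, dotProduct_smul, smul_dotProduct, smul_eq_mul, smul_eq_mul] at h1
  obtain rfl := mul_right_cancel₀ (dotProduct_pos hu hv).ne' h1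
  exact ⟨r, v, u, hr, hv, hu, hrv, hsu⟩

end Perron

/-! ### Identification of the spectral radius. -/

/-- The spectral radius of a nonnegative matrix with a positive eigenvector is the corresponding
eigenvalue. -/
lemma matrixSpectralRadius_eq {n : ℕ} [NeZero n] {A : Matrix (Fin n) (Fin n) ℝ}
    (hA : ∀ i j, 0 ≤ A i j) {r : ℝ} (hr : 0 < r) {v : Fin n → ℝ} (hv : ∀ i, 0 < v i)
    (h : A.mulVec v = r • v) : matrixSpectralRadius A = r := by
  have hmem : ∀ z : ℂ, z ∈ spectrum ℂ (A.map (algebraMap ℝ ℂ)) ↔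
      ∃ x : Fin n → ℂ, x ≠ 0 ∧ (A.map (algebraMap ℝ ℂ)).mulVec x = z • x := by
    intro z
    rw [← Matrix.spectrum_toLin', ← Module.End.hasEigenvalue_iff_mem_spectrum]
    constructor
    · intro hz
      obtain ⟨x, hx⟩ := hz.exists_hasEigenvector
      exact ⟨x, hx.2, by simpa using hx.apply_eq_smul⟩
    · rintro ⟨x, hx, hx'⟩
      exact Module.End.hasEigenvalue_of_hasEigenvector
        ⟨Module.End.mem_eigenspace_iff.2 (by simpa using hx'), hx⟩
  have hle : ∀ z ∈ spectrum ℂ (A.map (algebraMap ℝ ℂ)), ‖z‖ ≤ r := by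
    intro z hz
    obtain ⟨x, hx0, hx⟩ := (hmem z).1 hz
    -- In the sup norm weighted by `1 / v`, the matrix has operator norm at most `r`; the eigenvalue
    -- equation is read at an index attaining this norm of `x`.
    obtain ⟨i, hi⟩ := Finite.exists_max fun i => ‖x i‖ / v i
    have hi' : ∀ j, ‖x j‖ ≤ ‖x i‖ / v i * v j := fun j => (div_le_iff₀ (hv j)).1 (hi j)
    have hxi : 0 < ‖x i‖ := by
      by_contra hcon
      have h0 : ‖x i‖ = 0 := le_antisymm (not_lt.1 hcon) (norm_nonneg _)
      refine hx0 (funext fun j => norm_le_zero_iff.1 ?_)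
      simpa [h0] using hi' j
    have hzx : ‖z‖ * ‖x i‖ ≤ r * ‖x i‖ :=
      calc ‖z‖ * ‖x i‖ = ‖(A.map (algebraMap ℝ ℂ)).mulVec x i‖ := by rw [hx]; simp
        _ = ‖∑ j, (A i j : ℂ) * x j‖ := rfl
        _ ≤ ∑ j, ‖(A i j : ℂ) * x j‖ := norm_sum_le _ _
        _ ≤ ∑ j, ‖x i‖ / v i * (A i j * v j) := Finset.sum_le_sum fun j _ => by
          rw [norm_mul, Complex.norm_real, Real.norm_of_nonneg (hA i j)]
          have := mul_le_mul_of_nonneg_left (hi' j) (hA i j)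
          linarith
        _ = ‖x i‖ / v i * (r * v i) := by
          rw [← Finset.mul_sum]
          congr 1
          exact congrFun h i
        _ = r * ‖x i‖ := by
          field_simp [(hv i).ne']
    exact le_of_mul_le_mul_right hzx hxi
  have hr_mem : (r : ℂ) ∈ spectrum ℂ (A.map (algebraMap ℝ ℂ)) := by
    refine (hmem r).2 ⟨fun i => (v i : ℂ), fun h0 => ?_, funext fun i => ?_⟩
    · exact (hv 0).ne' (by simpa using congrFun h0 0)
    · have := congrArg (algebraMap ℝ ℂ) (congrFun h i)
      simpa [Matrix.mulVec, dotProduct] using this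
  have : spectralRadius ℂ (A.map (algebraMap ℝ ℂ)) = ENNReal.ofReal r := by
    refine le_antisymm (iSup₂_le fun z hz => ?_) ?_
    · rw [← enorm_eq_nnnorm, ← ofReal_norm]
      exact ENNReal.ofReal_le_ofReal (hle z hz)
    · calc ENNReal.ofReal r = (‖(r : ℂ)‖₊ : ENNReal) := by
            rw [← enorm_eq_nnnorm, ← ofReal_norm, Complex.norm_real, Real.norm_of_nonneg hr.le]
        _ ≤ _ := le_iSup₂ (f := fun (z : ℂ) (_ : z ∈ spectrum ℂ (A.map (algebraMap ℝ ℂ))) =>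
            (‖z‖₊ : ENNReal)) (r : ℂ) hr_mem
  rw [matrixSpectralRadius, this, ENNReal.toReal_ofReal hr.le]

/-! ### Perturbed orbits of a primitive matrix with eigenvalue one. -/

section Contraction

open Matrix

variable {ι : Type*} [Fintype ι]

/-- A weighted `ℓ¹` norm. -/
def weightedNorm (v x : ι → ℝ) : ℝ := ∑ i, |x i| * v i

lemma weightedNorm_nonneg {v : ι → ℝ} (hv : ∀ i, 0 < v i) (x : ι → ℝ) : 0 ≤ weightedNorm v x :=
  Finset.sum_nonneg fun i _ => mul_nonneg (abs_nonneg _) (hv i).le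

lemma weightedNorm_add_le {v : ι → ℝ} (hv : ∀ i, 0 < v i) (x y : ι → ℝ) :
    weightedNorm v (x + y) ≤ weightedNorm v x + weightedNorm v y := by
  rw [weightedNorm, weightedNorm, weightedNorm, ← Finset.sum_add_distrib]
  refine Finset.sum_le_sum fun i _ => ?_
  rw [← add_mul]
  exact mul_le_mul_of_nonneg_right (abs_add_le _ _) (hv i).le

/-- A matrix with right eigenvector `v` that dominates a multiple of `v ⊗ u` contracts the
weighted norm on vectors orthogonal to `v`. -/
lemma weightedNorm_vecMul_le {B : Matrix ι ι ℝ} {u v : ι → ℝ} (hv : ∀ i, 0 < v i)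
    (hBv : B *ᵥ v = v) {c : ℝ} (hc : ∀ i j, c * (v i * u j) ≤ B i j) {x : ι → ℝ}
    (hx : c = 0 ∨ x ⬝ᵥ v = 0) :
    weightedNorm v (x ᵥ* B) ≤ (1 - c * (u ⬝ᵥ v)) * weightedNorm v x := by
  -- Subtracting `c • v ⊗ u` from `B` does not change `x ᵥ* B`, but leaves a nonnegative matrix with
  -- smaller weighted row sums. The case `c = 0` is nonexpansiveness for every `x`.
  have h1 : ∀ j, (x ᵥ* B) j = ∑ i, x i * (B i j - c * (v i * u j)) := by
    intro j
    have : ∑ i, x i * (c * (v i * u j)) = c * (x ⬝ᵥ v) * u j := by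
      rw [dotProduct, Finset.mul_sum, Finset.sum_mul]
      exact Finset.sum_congr rfl fun i _ => by ring
    have h0 : c * (x ⬝ᵥ v) * u j = 0 := by rcases hx with h | h <;> simp [h]
    simp only [mul_sub, Finset.sum_sub_distrib, this, h0, sub_zero]
    rfl
  calc weightedNorm v (x ᵥ* B) ≤ ∑ j, (∑ i, |x i| * (B i j - c * (v i * u j))) * v j := by
        refine Finset.sum_le_sum fun j _ => mul_le_mul_of_nonneg_right ?_ (hv j).le
        rw [h1]
        refine (Finset.abs_sum_le_sum_abs _ _).trans (Finset.sum_le_sum fun i _ => ?_)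
        rw [abs_mul, abs_of_nonneg (sub_nonneg.2 (hc i j))]
    _ = ∑ i, |x i| * ((B *ᵥ v) i - c * v i * (u ⬝ᵥ v)) := by
        simp only [mulVec, dotProduct, Finset.sum_mul, Finset.mul_sum, ← Finset.sum_sub_distrib]
        rw [Finset.sum_comm]
        exact Finset.sum_congr rfl fun i _ => Finset.sum_congr rfl fun j _ => by ring
    _ = (1 - c * (u ⬝ᵥ v)) * weightedNorm v x := by
        rw [hBv, weightedNorm, Finset.mul_sum]
        exact Finset.sum_congr rfl fun i _ => by ring

/-- A nonnegative sequence contracted by a fixed factor over `k` steps, up to a summable error,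
is summable. -/
lemma summable_of_contraction {a η : ℕ → ℝ} (ha : ∀ t, 0 ≤ a t) (hη0 : ∀ t, 0 ≤ η t)
    (hη : Summable η) {r : ℝ} (hr : r < 1) (k : ℕ)
    (h : ∀ t, a (t + k) ≤ r * a t + η t) : Summable a := by
  have hr0 : 0 < 1 - r := by linarith
  refine summable_of_sum_range_le (c := (∑ t ∈ Finset.range k, a t + ∑' t, η t) / (1 - r)) ha
    fun N => ?_
  rw [le_div_iff₀ hr0]
  -- Summing the recursion gives a bound on `(1 - r)` times the partial sum that does not depend on
  -- `N`; no lower bound on `r` is needed.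
  have h1 : ∑ t ∈ Finset.range N, a (t + k) ≤ r * ∑ t ∈ Finset.range N, a t + ∑' t, η t := by
    calc _ ≤ ∑ t ∈ Finset.range N, (r * a t + η t) := Finset.sum_le_sum fun t _ => h t
      _ = r * ∑ t ∈ Finset.range N, a t + ∑ t ∈ Finset.range N, η t := by
        rw [Finset.sum_add_distrib, Finset.mul_sum]
      _ ≤ _ := by
        have := hη.sum_le_tsum (Finset.range N) fun t _ => hη0 t
        linarith
  have h2 : ∑ t ∈ Finset.range N, a t ≤
      ∑ t ∈ Finset.range k, a t + ∑ t ∈ Finset.range N, a (t + k) := by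
    calc _ ≤ ∑ t ∈ Finset.range (k + N), a t :=
          Finset.sum_le_sum_of_subset_of_nonneg
            (Finset.range_subset_range.2 (Nat.le_add_left N k)) fun t _ _ => ha t
      _ = _ := by
        rw [Finset.sum_range_add]
        simp only [Nat.add_comm k]
  linarith

/-- A perturbed orbit of a primitive matrix with eigenvalue `1`, orthogonal to the right
eigenvector, tends to `0`. -/
lemma tendsto_zero_of_perturbed_orbit [DecidableEq ι] [Nonempty ι] {B : Matrix ι ι ℝ}
    (hB : B.IsPrimitive) {u v : ι → ℝ} (hu : ∀ i, 0 < u i) (hv : ∀ i, 0 < v i)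
    (hBv : B *ᵥ v = v) {w ε : ℕ → ι → ℝ} (hw : ∀ t, w (t + 1) = w t ᵥ* B + ε t)
    (hwv : ∀ t, w t ⬝ᵥ v = 0) (hε : Summable fun t => weightedNorm v (ε t)) :
    Tendsto (fun t => weightedNorm v (w t)) atTop (𝓝 0) := by
  obtain ⟨k, hk, hpos⟩ := hB.exists_pos_pow
  -- This `c` makes `B ^ k` dominate `c • v ⊗ u`, so `k` steps contract strictly on vectors
  -- orthogonal to `v`.
  obtain ⟨c, hc, hcle⟩ := exists_pos_forall_le (fun q : ι × ι => (B ^ k) q.1 q.2 / (v q.1 * u q.2))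
    fun q => div_pos (hpos _ _) (mul_pos (hv _) (hu _))
  have hstep : ∀ j t, ∃ η : ι → ℝ, w (t + j) = w t ᵥ* (B ^ j) + η ∧
      weightedNorm v η ≤ ∑ s ∈ Finset.range j, weightedNorm v (ε (t + s)) := by
    intro j
    induction j with
    | zero => intro t; exact ⟨0, by simp, by simp [weightedNorm]⟩
    | succ j ih =>
      intro t
      obtain ⟨η, h1, h2⟩ := ih t
      refine ⟨η ᵥ* B + ε (t + j), ?_, ?_⟩
      · rw [← add_assoc, hw, h1, add_vecMul, vecMul_vecMul, ← pow_succ, add_assoc]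
      · rw [Finset.sum_range_succ]
        refine (weightedNorm_add_le hv _ _).trans (add_le_add_left (le_trans ?_ h2) _)
        have := weightedNorm_vecMul_le (u := u) hv hBv (c := 0)
          (fun i j => by simpa using hB.nonneg i j) (x := η) (Or.inl rfl)
        simpa using this
  refine (summable_of_contraction (r := 1 - c * (u ⬝ᵥ v)) (k := k) (fun t => weightedNorm_nonneg hv _)
    (fun t => Finset.sum_nonneg fun s (_ : s ∈ Finset.range k) => weightedNorm_nonneg hv (ε (t + s)))
    (summable_sum fun s _ => (summable_nat_add_iff s).2 hε)
    (by have := mul_pos hc (dotProduct_pos hu hv); linarith) fun t => ?_).tendsto_atTop_zero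
  obtain ⟨η, h1, h2⟩ := hstep k t
  rw [h1]
  refine (weightedNorm_add_le hv _ _).trans (add_le_add ?_ h2)
  refine weightedNorm_vecMul_le hv ?_ (fun i j => ?_) (Or.inr (hwv t))
  · rw [pow_mulVec_of_eigen (r := 1) (by rw [hBv, one_smul]) k, one_pow, one_smul]
  · exact (le_div_iff₀ (mul_pos (hv i) (hu j))).1 (hcle (i, j))

/-- A perturbed orbit of a primitive matrix with eigenvalue `1` converges to a multiple of the
left eigenvector. -/
lemma tendsto_of_perturbed_orbit [DecidableEq ι] [Nonempty ι] {B : Matrix ι ι ℝ}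
    (hB : B.IsPrimitive) {u v : ι → ℝ} (hu : ∀ i, 0 < u i) (hv : ∀ i, 0 < v i)
    (hBv : B *ᵥ v = v) (huB : u ᵥ* B = u) {y ε : ℕ → ι → ℝ}
    (hy : ∀ t, y (t + 1) = y t ᵥ* B + ε t)
    (hε : ∀ i, Summable fun t => |ε t i|) :
    ∃ W : ℝ, Tendsto (fun t => y t ⬝ᵥ v) atTop (𝓝 W) ∧
      ∀ i, Tendsto (fun t => y t i) atTop (𝓝 (W / (u ⬝ᵥ v) * u i)) := by
  have huv := dotProduct_pos hu hv
  have hεw : Summable fun t => weightedNorm v (ε t) :=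
    summable_sum fun i _ => (hε i).mul_right (v i)
  have hM : ∀ t, y (t + 1) ⬝ᵥ v = y t ⬝ᵥ v + ε t ⬝ᵥ v := by
    intro t
    rw [hy, add_dotProduct, ← dotProduct_mulVec, hBv]
  have habs : ∀ t, |ε t ⬝ᵥ v| ≤ weightedNorm v (ε t) := by
    intro t
    refine (Finset.abs_sum_le_sum_abs _ _).trans (Finset.sum_le_sum fun i _ => ?_)
    rw [abs_mul, abs_of_pos (hv i)]
  have hεv : Summable fun t => |ε t ⬝ᵥ v| :=
    Summable.of_nonneg_of_le (fun t => abs_nonneg _) habs hεw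
  have hsum : ∀ t, y t ⬝ᵥ v = y 0 ⬝ᵥ v + ∑ s ∈ Finset.range t, ε s ⬝ᵥ v := by
    intro t
    induction t with
    | zero => simp
    | succ t ih => rw [hM, ih, Finset.sum_range_succ, add_assoc]
  obtain ⟨W, hW⟩ : ∃ W, Tendsto (fun t => y t ⬝ᵥ v) atTop (𝓝 W) := by
    refine ⟨y 0 ⬝ᵥ v + ∑' s, ε s ⬝ᵥ v, ?_⟩
    rw [funext hsum]
    exact hεv.of_abs.hasSum.tendsto_sum_nat.const_add _
  refine ⟨W, hW, fun i => ?_⟩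
  -- The projection along `u` onto the vectors orthogonal to `v` commutes with `B`, so `w` is again
  -- a perturbed orbit, driven by the projected errors.
  set w : ℕ → ι → ℝ := fun t => y t - ((y t ⬝ᵥ v) / (u ⬝ᵥ v)) • u
  have hw0 := tendsto_zero_of_perturbed_orbit (w := w)
    (ε := fun t => ε t + (-((ε t ⬝ᵥ v) / (u ⬝ᵥ v))) • u) hB hu hv hBv
    (fun t => by
      simp only [w]
      rw [hM, hy, sub_vecMul, smul_vecMul, huB, add_div, add_smul, neg_smul]
      abel)
    (fun t => by
      simp only [w]
      rw [sub_dotProduct, smul_dotProduct, smul_eq_mul, div_mul_cancel₀ _ huv.ne', sub_self])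
    (by
      refine Summable.of_nonneg_of_le (fun t => weightedNorm_nonneg hv _)
        (fun t => weightedNorm_add_le hv _ _) (hεw.add ?_)
      have : ∀ t, weightedNorm v (-(ε t ⬝ᵥ v / (u ⬝ᵥ v)) • u) = |ε t ⬝ᵥ v| := by
        intro t
        have h : weightedNorm v (-(ε t ⬝ᵥ v / (u ⬝ᵥ v)) • u) =
            |ε t ⬝ᵥ v| / (u ⬝ᵥ v) * (u ⬝ᵥ v) := by
          simp only [weightedNorm, dotProduct, Finset.mul_sum, Pi.smul_apply, smul_eq_mul, abs_mul,
            abs_neg, abs_div]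
          refine Finset.sum_congr rfl fun j _ => ?_
          rw [abs_of_pos (hu j), abs_of_pos (show 0 < ∑ i, u i * v i from huv)]
          ring
        rw [h, div_mul_cancel₀ _ huv.ne']
      simpa only [this] using hεv)
  have hwi : Tendsto (fun t => w t i) atTop (𝓝 0) := by
    refine squeeze_zero_norm (fun t => ?_) (by simpa using hw0.div_const (v i))
    rw [le_div_iff₀ (hv i)]
    exact Finset.single_le_sum (f := fun j => |w t j| * v j)
      (fun j _ => mul_nonneg (abs_nonneg _) (hv j).le) (Finset.mem_univ i)
  have := hwi.add ((hW.div_const (u ⬝ᵥ v)).mul_const (u i))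
  simpa [w] using this

end Contraction

/-! ### The mean matrix and its growth rate. -/

section MeanMatrix

open Matrix

variable {n m : ℕ} {X : Fin m → Matrix (Fin n) (Fin n) ℕ} {p : Fin m → ℝ}

lemma meanMatrix_apply (i l : Fin n) : meanMatrix X p i l = ∑ j, p j * (X j i l : ℝ) := by
  simp [meanMatrix, Matrix.sum_apply]

lemma meanMatrix_mulVec (f : Fin n → ℝ) (i : Fin n) :
    (meanMatrix X p *ᵥ f) i = ∑ j, p j * ((fun l => (X j i l : ℝ)) ⬝ᵥ f) := by
  simp only [mulVec, dotProduct, meanMatrix_apply, Finset.sum_mul, Finset.mul_sum, mul_assoc]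
  exact Finset.sum_comm

lemma pow_le_pow_entrywise {A B : Matrix (Fin n) (Fin n) ℝ} (hA : ∀ i j, 0 ≤ A i j)
    (hAB : ∀ i j, A i j ≤ B i j) (k : ℕ) : ∀ i j, 0 ≤ (A ^ k) i j ∧ (A ^ k) i j ≤ (B ^ k) i j := by
  induction k with
  | zero => exact fun i j => ⟨by rw [pow_zero, one_apply]; split_ifs <;> norm_num, by simp⟩
  | succ k ih =>
    intro i j
    simp only [pow_succ, mul_apply]
    exact ⟨Finset.sum_nonneg fun l _ => mul_nonneg (ih i l).1 (hA l j),
      Finset.sum_le_sum fun l _ => mul_le_mul (ih i l).2 (hAB l j) (hA l j)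
        ((ih i l).1.trans (ih i l).2)⟩

/-- A single primitive summand suffices: the mean matrix dominates `p j₀ • X j₀` entrywise, and so
do its powers. -/
lemma meanMatrix_isPrimitive (hX : ∀ j, ((X j).map (Nat.cast : ℕ → ℝ)).IsPrimitive)
    (hp : ∀ j, 0 < p j) (j₀ : Fin m) : (meanMatrix X p).IsPrimitive where
  nonneg i l := by
    rw [meanMatrix_apply]
    exact Finset.sum_nonneg fun j _ => mul_nonneg (hp j).le (Nat.cast_nonneg _)
  exists_pos_pow := by
    obtain ⟨k, hk, hpos⟩ := (hX j₀).exists_pos_pow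
    refine ⟨k, hk, fun i l => ?_⟩
    have h := (pow_le_pow_entrywise (A := p j₀ • (X j₀).map (Nat.cast : ℕ → ℝ))
      (B := meanMatrix X p) (fun i l => mul_nonneg (hp j₀).le (Nat.cast_nonneg _))
      (fun i l => by
        rw [meanMatrix_apply]
        exact Finset.single_le_sum (f := fun j => p j * (X j i l : ℝ))
          (fun j _ => mul_nonneg (hp j).le (Nat.cast_nonneg _)) (Finset.mem_univ j₀)) k i l).2
    rw [smul_pow] at h
    exact lt_of_lt_of_le (mul_pos (pow_pos (hp j₀) k) (hpos i l)) h

/-- A zero row would remain zero in every positive power. Hence each individual has at least one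
descendant at every step. -/
lemma one_le_row_sum {Y : Matrix (Fin n) (Fin n) ℕ} (hY : (Y.map (Nat.cast : ℕ → ℝ)).IsPrimitive)
    (i : Fin n) : 1 ≤ ∑ l, Y i l := by
  obtain ⟨k, hk, hpos⟩ := hY.exists_pos_pow
  by_contra hlt
  have h0 : ∀ l, Y i l = 0 := fun l => by
    have : Y i l ≤ ∑ l, Y i l :=
      Finset.single_le_sum (fun _ _ => Nat.zero_le _) (Finset.mem_univ l)
    omega
  obtain ⟨k, rfl⟩ := Nat.exists_eq_succ_of_ne_zero hk.ne'
  have := hpos i i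
  simp [pow_succ', mul_apply, h0] at this

/-- The growth rate is at least `1`. -/
lemma one_le_eigenvalue [NeZero n] (hX : ∀ j i, 1 ≤ ∑ l, X j i l) (hp : ∀ j, 0 < p j)
    (hp_sum : ∑ j, p j = 1) {r : ℝ} {u : Fin n → ℝ} (hu : ∀ i, 0 < u i)
    (h : u ᵥ* meanMatrix X p = r • u) :
    1 ≤ r ∧ (r = 1 → ∀ j i, ∑ l, X j i l = 1) := by
  have hrow : ∀ i, (meanMatrix X p *ᵥ 1) i = ∑ j, p j * ((∑ l, X j i l : ℕ) : ℝ) := by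
    intro i
    rw [meanMatrix_mulVec]
    simp [dotProduct]
  have hrow1 : ∀ i, (meanMatrix X p *ᵥ 1) i - 1 = ∑ j, p j * (((∑ l, X j i l : ℕ) : ℝ) - 1) := by
    intro i
    rw [hrow]
    simp only [mul_sub, Finset.sum_sub_distrib, mul_one, hp_sum]
  have hX' : ∀ j i, (0 : ℝ) ≤ ((∑ l, X j i l : ℕ) : ℝ) - 1 := fun j i =>
    sub_nonneg.2 (by exact_mod_cast hX j i)
  have hnn : ∀ i, 0 ≤ (meanMatrix X p *ᵥ 1) i - 1 := fun i => by
    rw [hrow1]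
    exact Finset.sum_nonneg fun j _ => mul_nonneg (hp j).le (hX' j i)
  -- Weighting the excess of each row sum over `1` by `u` gives `(r - 1) * ∑ i, u i`. All terms are
  -- nonnegative, so `r ≥ 1`, with equality only if every excess vanishes.
  have h1 : ∑ i, u i * ((meanMatrix X p *ᵥ 1) i - 1) = (r - 1) * ∑ i, u i := by
    have h2 : u ⬝ᵥ (meanMatrix X p *ᵥ 1) = r * ∑ i, u i := by
      rw [dotProduct_mulVec, h, smul_dotProduct, smul_eq_mul]
      simp [dotProduct]
    simp only [mul_sub, Finset.sum_sub_distrib, mul_one, sub_mul, one_mul]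
    rw [← h2]
    rfl
  have hus : 0 < ∑ i, u i := Finset.sum_pos (fun i _ => hu i) Finset.univ_nonempty
  refine ⟨?_, ?_⟩
  · have : 0 ≤ (r - 1) * ∑ i, u i :=
      h1 ▸ Finset.sum_nonneg fun i _ => mul_nonneg (hu i).le (hnn i)
    have := nonneg_of_mul_nonneg_left this hus
    linarith
  · rintro rfl j i
    rw [sub_self, zero_mul, Finset.sum_eq_zero_iff_of_nonneg
      fun i _ => mul_nonneg (hu i).le (hnn i)] at h1
    have h2 := (mul_eq_zero.1 (h1 i (Finset.mem_univ i))).resolve_left (hu i).ne'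
    rw [hrow1, Finset.sum_eq_zero_iff_of_nonneg fun j _ => mul_nonneg (hp j).le (hX' j i)] at h2
    have h3 := (mul_eq_zero.1 (h2 j (Finset.mem_univ j))).resolve_left (hp j).ne'
    exact_mod_cast sub_eq_zero.1 h3

end MeanMatrix

/-! ### Modification on a null set. -/

section Regularization

variable {Ω : Type*} [MeasurableSpace Ω] {P : Measure Ω} {n m : ℕ}
  {X : Fin m → Matrix (Fin n) (Fin n) ℕ} {p : Fin m → ℝ} {R : ℕ → Fin n → ℕ → Ω → (Fin n → ℕ)}

/-- A replacement family of measurable functions all of whose values are rows of the matrices. -/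
structure IsRegularReplacementFamily (P : Measure Ω) (X : Fin m → Matrix (Fin n) (Fin n) ℕ)
    (p : Fin m → ℝ) (R : ℕ → Fin n → ℕ → Ω → (Fin n → ℕ)) : Prop
    extends IsReplacementFamily P X p R where
  measurable : ∀ t i k, Measurable (R t i k)
  exists_eq_row : ∀ t i k ω, ∃ j, R t i k ω = X j i

lemma ae_replacementLaw (i : Fin n) : ∀ᵐ r ∂replacementLaw X p i, ∃ j, r = X j i := by
  rw [replacementLaw, ae_finsetSum_measure_iff]
  intro j _
  exact Measure.ae_smul_measure ((ae_dirac_iff (MeasurableSet.of_discrete)).2 ⟨j, rfl⟩) _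

/-- Every replacement family has a regular modification. -/
lemma IsReplacementFamily.exists_regular (hR : IsReplacementFamily P X p R) (j₀ : Fin m) :
    ∃ R', IsRegularReplacementFamily P X p R' ∧ ∀ᵐ ω ∂P, ∀ t i k, R t i k ω = R' t i k ω := by
  classical
  -- Values outside the support of the law form a null event and are reset to a row of `X j₀`.
  let φ : Fin n → (Fin n → ℕ) → (Fin n → ℕ) := fun i r => if ∃ j, r = X j i then r else X j₀ i
  let R' : ℕ → Fin n → ℕ → Ω → (Fin n → ℕ) := fun t i k =>
    φ i ∘ (hR.hasLaw t i k).aemeasurable.mk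
  have hae : ∀ t i k, R t i k =ᵐ[P] R' t i k := by
    intro t i k
    have h1 : ∀ᵐ ω ∂P, ∃ j, R t i k ω = X j i :=
      ((hR.hasLaw t i k).ae_iff (Measurable.of_discrete)).2 (ae_replacementLaw i)
    filter_upwards [h1, (hR.hasLaw t i k).aemeasurable.ae_eq_mk] with ω h1 h2
    simp only [R', φ, Function.comp, ← h2]
    rw [if_pos h1]
  refine ⟨R', ⟨⟨fun t i k => (hR.hasLaw t i k).congr (hae t i k).symm, ?_⟩, fun t i k => ?_,
    fun t i k ω => ?_⟩, ?_⟩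
  · have h := hR.indep
    refine (iIndepFun_congr ?_).1 h
    exact fun a => hae a.1 a.2.1 a.2.2
  · exact Measurable.of_discrete.comp (hR.hasLaw t i k).aemeasurable.measurable_mk
  · simp only [R', φ, Function.comp]
    split_ifs with h
    · exact h
    · exact ⟨j₀, rfl⟩
  · simp only [ae_all_iff]
    exact hae

omit [MeasurableSpace Ω] in
lemma substitutionVector_congr {R' : ℕ → Fin n → ℕ → Ω → (Fin n → ℕ)} {ω : Ω}
    (h : ∀ t i k, R t i k ω = R' t i k ω) (α₀ : Fin n → ℕ) (t : ℕ) :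
    substitutionVector R α₀ t ω = substitutionVector R' α₀ t ω := by
  induction t with
  | zero => rfl
  | succ t ih => simp only [substitutionVector, ih, h]

end Regularization

/-! ### Past and present randomness. -/

section Filtration

variable {Ω : Type*} [mΩ : MeasurableSpace Ω] {P : Measure Ω} {n m : ℕ}
  {X : Fin m → Matrix (Fin n) (Fin n) ℕ} {p : Fin m → ℝ} {R : ℕ → Fin n → ℕ → Ω → (Fin n → ℕ)}

/-- The σ-algebra of the replacements made before time `t`. -/
@[reducible] def pastSigma (R : ℕ → Fin n → ℕ → Ω → (Fin n → ℕ)) (t : ℕ) : MeasurableSpace Ω :=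
  ⨆ a ∈ {a : ℕ × Fin n × ℕ | a.1 < t},
    MeasurableSpace.comap (R a.1 a.2.1 a.2.2) MeasurableSpace.pi

/-- The σ-algebra of the replacements made in the step from `t` to `t + 1`. -/
@[reducible] def stepSigma (R : ℕ → Fin n → ℕ → Ω → (Fin n → ℕ)) (t : ℕ) : MeasurableSpace Ω :=
  ⨆ a ∈ {a : ℕ × Fin n × ℕ | a.1 = t},
    MeasurableSpace.comap (R a.1 a.2.1 a.2.2) MeasurableSpace.pi

omit mΩ in
lemma pastSigma_mono : Monotone (pastSigma R) := fun _ _ hst =>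
  biSup_mono fun _ ha => lt_of_lt_of_le ha hst

omit mΩ in
lemma stepSigma_le_pastSigma_succ (t : ℕ) : stepSigma R t ≤ pastSigma R (t + 1) :=
  biSup_mono fun _ ha => Nat.lt_succ_of_le (le_of_eq ha)

omit mΩ in
lemma measurable_stepSigma (t : ℕ) (i : Fin n) (k : ℕ) : Measurable[stepSigma R t] (R t i k) :=
  Measurable.mono (comap_measurable _)
    (le_biSup (fun a : ℕ × Fin n × ℕ => MeasurableSpace.comap (R a.1 a.2.1 a.2.2)
      MeasurableSpace.pi) (i := (t, i, k)) rfl) le_rfl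

namespace IsRegularReplacementFamily

lemma pastSigma_le (hR : IsRegularReplacementFamily P X p R) (t : ℕ) : pastSigma R t ≤ mΩ :=
  iSup₂_le fun a _ => (hR.measurable a.1 a.2.1 a.2.2).comap_le

lemma stepSigma_le (hR : IsRegularReplacementFamily P X p R) (t : ℕ) : stepSigma R t ≤ mΩ :=
  iSup₂_le fun a _ => (hR.measurable a.1 a.2.1 a.2.2).comap_le

/-- The two σ-algebras are generated by disjoint blocks of one independent family. -/
lemma indep_pastSigma_stepSigma (hR : IsRegularReplacementFamily P X p R) (t : ℕ) :
    Indep (pastSigma R t) (stepSigma R t) P := by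
  have h := hR.indep
  have h' := (iIndepFun_iff_iIndep _ _ _).1 h
  have hST : Disjoint {a : ℕ × Fin n × ℕ | a.1 < t} {a | a.1 = t} :=
    Set.disjoint_left.2 fun a (ha : a.1 < t) (ha' : a.1 = t) => ha.ne ha'
  have hle : ∀ a : ℕ × Fin n × ℕ,
      MeasurableSpace.comap (R a.1 a.2.1 a.2.2) MeasurableSpace.pi ≤ mΩ :=
    fun a => (hR.measurable a.1 a.2.1 a.2.2).comap_le
  exact indep_iSup_of_disjoint hle h' hST

/-- The filtration of the process. -/
def filtration (hR : IsRegularReplacementFamily P X p R) : Filtration ℕ mΩ where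
  seq := pastSigma R
  mono' := pastSigma_mono
  le' := hR.pastSigma_le

end IsRegularReplacementFamily

omit mΩ in
lemma measurable_substitutionVector (α₀ : Fin n → ℕ) (t : ℕ) :
    Measurable[pastSigma R t] (substitutionVector R α₀ t) := by
  induction t with
  | zero => exact measurable_const
  | succ t ih =>
    have h1 : Measurable[pastSigma R (t + 1)] (substitutionVector R α₀ t) :=
      ih.mono (pastSigma_mono (Nat.le_succ t)) le_rfl
    -- The number of summands is random. As the state space is countable, joint measurability
    -- follows from measurability for each frozen state `x`.
    have h2 : ∀ x : Fin n → ℕ,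
        Measurable[pastSigma R (t + 1)] fun ω => substitute (fun i k => R t i k ω) x := by
      intro x
      let := pastSigma R (t + 1)
      have : ∀ i k, Measurable (R t i k) := fun i k =>
        (measurable_stepSigma t i k).mono (stepSigma_le_pastSigma_succ t) le_rfl
      unfold substitute
      fun_prop
    let := pastSigma R (t + 1)
    have h3 : Measurable fun q : (Fin n → ℕ) × Ω => substitute (fun i k => R t i k q.2) q.1 :=
      measurable_from_prod_countable_right h2
    exact h3.comp (h1.prodMk measurable_id)

/-- There are only finitely many rows, so growth per step is bounded deterministically. This makes
the later integrands bounded and the population at a given time finitely valued. -/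
lemma IsRegularReplacementFamily.exists_bound (hR : IsRegularReplacementFamily P X p R)
    (α₀ : Fin n → ℕ) (t : ℕ) : ∃ N : ℕ, ∀ ω l, substitutionVector R α₀ t ω l ≤ N := by
  induction t with
  | zero => exact ⟨∑ l, α₀ l, fun ω l => Finset.single_le_sum (fun _ _ => Nat.zero_le _)
      (Finset.mem_univ l)⟩
  | succ t ih =>
    obtain ⟨N, hN⟩ := ih
    let K := ∑ j, ∑ i, ∑ l, X j i l
    have hK : ∀ i k ω l, R t i k ω l ≤ K := by
      intro i k ω l
      obtain ⟨j, hj⟩ := hR.exists_eq_row t i k ω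
      rw [hj]
      exact (Finset.single_le_sum (f := fun l => X j i l) (fun _ _ => Nat.zero_le _)
        (Finset.mem_univ l)).trans ((Finset.single_le_sum (f := fun i => ∑ l, X j i l)
          (fun _ _ => Nat.zero_le _) (Finset.mem_univ i)).trans
            (Finset.single_le_sum (f := fun j => ∑ i, ∑ l, X j i l)
          (fun _ _ => Nat.zero_le _) (Finset.mem_univ j)))
    refine ⟨∑ _i : Fin n, N * K, fun ω l => ?_⟩
    simp only [substitutionVector, substitute, Finset.sum_apply]
    refine Finset.sum_le_sum fun i _ => ?_
    calc _ ≤ ∑ k ∈ Finset.range (substitutionVector R α₀ t ω i), K :=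
          Finset.sum_le_sum fun k _ => hK i k ω l
      _ ≤ N * K := by
        rw [Finset.sum_const, Finset.card_range, smul_eq_mul]
        exact Nat.mul_le_mul_right K (hN ω i)

end Filtration

/-! ### Conditioning on the current population. -/

section Freezing

variable {Ω : Type*} [mΩ : MeasurableSpace Ω] {P : Measure Ω} [IsProbabilityMeasure P]

/-- Integrating out an independent family of random variables evaluated at a random index with
finitely many values. -/
lemma integral_mul_eval_eq {S : Type*} [MeasurableSpace S] [MeasurableSingletonClass S]
    {m₁ m₂ : MeasurableSpace Ω} (hm₁ : m₁ ≤ mΩ) (hm₂ : m₂ ≤ mΩ) (hind : Indep m₁ m₂ P)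
    {α : Ω → S} (hα : Measurable[m₁] α) {F : Finset S} (hF : ∀ ω, α ω ∈ F)
    {H : Ω → ℝ} (hH : Measurable[m₁] H) {C : ℝ} (hC : ∀ ω, |H ω| ≤ C)
    {Φ : S → Ω → ℝ} (hΦ : ∀ x, Measurable[m₂] (Φ x)) {D : S → ℝ} (hD : ∀ x ω, |Φ x ω| ≤ D x) :
    ∫ ω, H ω * Φ (α ω) ω ∂P = ∫ ω, H ω * (∫ ω', Φ (α ω) ω' ∂P) ∂P := by
  classical
  -- Splitting `H` over the events `α = x` turns the integrand into a finite sum of products of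
  -- independent factors.
  let I : S → Ω → ℝ := fun x => (α ⁻¹' {x}).indicator H
  have hI : ∀ x, Measurable[m₁] (I x) := fun x =>
    Measurable.indicator hH (hα (measurableSet_singleton x))
  have hIC : ∀ x ω, |I x ω| ≤ C := by
    intro x ω
    simp only [I, Set.indicator]
    split_ifs
    · exact hC ω
    · simpa using (abs_nonneg _).trans (hC ω)
  have hsum : ∀ (G : S → ℝ) ω, H ω * G (α ω) = ∑ x ∈ F, I x ω * G x := by
    intro G ω
    rw [Finset.sum_eq_single_of_mem (α ω) (hF ω)]
    · simp [I]
    · intro x _ hx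
      simp [I, hx.symm]
  have hIint : ∀ x, Integrable (I x) P := fun x =>
    Integrable.of_bound ((hI x).mono hm₁ le_rfl).aestronglyMeasurable C
      (ae_of_all _ fun ω => hIC x ω)
  have hIΦint : ∀ x, Integrable (fun ω => I x ω * Φ x ω) P := fun x =>
    Integrable.of_bound (((hI x).mono hm₁ le_rfl).mul
      ((hΦ x).mono hm₂ le_rfl)).aestronglyMeasurable (C * D x)
      (ae_of_all _ fun ω => by
        rw [Real.norm_eq_abs, abs_mul]
        exact mul_le_mul (hIC x ω) (hD x ω) (abs_nonneg _) ((abs_nonneg _).trans (hIC x ω)))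
  rw [integral_congr_ae (ae_of_all P fun ω => hsum (fun x => Φ x ω) ω),
    integral_congr_ae (ae_of_all P fun ω => hsum (fun x => ∫ ω', Φ x ω' ∂P) ω),
    integral_finsetSum _ fun x _ => hIΦint x,
    integral_finsetSum _ fun x _ => (hIint x).mul_const _]
  refine Finset.sum_congr rfl fun x _ => ?_
  rw [integral_mul_const]
  refine IndepFun.integral_fun_mul_eq_mul_integral ?_
    ((hI x).mono hm₁ le_rfl).aestronglyMeasurable ((hΦ x).mono hm₂ le_rfl).aestronglyMeasurable
  rw [IndepFun_iff_Indep]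
  exact indep_of_indep_of_le_left (indep_of_indep_of_le_right hind (hΦ x).comap_le) (hI x).comap_le

end Freezing

/-! ### First and second moments of the noise. -/

section Noise

open Matrix

variable {Ω : Type*} [mΩ : MeasurableSpace Ω] {P : Measure Ω} {n m : ℕ}
  {X : Fin m → Matrix (Fin n) (Fin n) ℕ} {p : Fin m → ℝ} {R : ℕ → Fin n → ℕ → Ω → (Fin n → ℕ)}

/-- The linear functional `f` on integer vectors. -/
def natPairing (f : Fin n → ℝ) (x : Fin n → ℕ) : ℝ := (fun l => (x l : ℝ)) ⬝ᵥ f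

lemma natPairing_sum {κ : Type*} (f : Fin n → ℝ) (s : Finset κ) (x : κ → Fin n → ℕ) :
    natPairing f (∑ q ∈ s, x q) = ∑ q ∈ s, natPairing f (x q) := by
  simp only [natPairing, dotProduct, Finset.sum_apply, Nat.cast_sum, Finset.sum_mul]
  exact Finset.sum_comm

/-- The deviation of a single replacement from its mean, seen through the functional `f`. -/
def centered (A : Matrix (Fin n) (Fin n) ℝ) (R : ℕ → Fin n → ℕ → Ω → (Fin n → ℕ))
    (f : Fin n → ℝ) (t : ℕ) (i : Fin n) (k : ℕ) (ω : Ω) : ℝ :=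
  natPairing f (R t i k ω) - (A *ᵥ f) i

/-- The deviation of a substitution step from its conditional mean, seen through `f`. -/
def noise (A : Matrix (Fin n) (Fin n) ℝ) (R : ℕ → Fin n → ℕ → Ω → (Fin n → ℕ)) (α₀ : Fin n → ℕ)
    (f : Fin n → ℝ) (t : ℕ) (ω : Ω) : ℝ :=
  natPairing f (substitutionVector R α₀ (t + 1) ω) -
    natPairing (A *ᵥ f) (substitutionVector R α₀ t ω)

omit mΩ in
-- Distributing the conditional mean over the individuals leaves one centered term each; the index
-- set depends only on the past.
lemma noise_eq (A : Matrix (Fin n) (Fin n) ℝ) (α₀ : Fin n → ℕ) (f : Fin n → ℝ) (t : ℕ) (ω : Ω) :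
    noise A R α₀ f t ω =
      ∑ q ∈ Finset.univ.sigma fun i => Finset.range (substitutionVector R α₀ t ω i),
        centered A R f t q.1 q.2 ω := by
  rw [Finset.sum_sigma]
  simp only [noise, substitutionVector, substitute, centered, natPairing_sum,
    Finset.sum_sub_distrib, Finset.sum_const, Finset.card_range, nsmul_eq_mul]
  rfl

namespace IsRegularReplacementFamily

lemma measurable_natPairing (f : Fin n → ℝ) : Measurable (natPairing f) := Measurable.of_discrete

omit mΩ in
lemma measurable_centered (A : Matrix (Fin n) (Fin n) ℝ) (f : Fin n → ℝ) (t : ℕ) (i : Fin n)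
    (k : ℕ) : Measurable[stepSigma R t] (centered A R f t i k) :=
  ((measurable_natPairing f).comp (measurable_stepSigma t i k)).sub_const _

lemma exists_centered_bound (hR : IsRegularReplacementFamily P X p R)
    (A : Matrix (Fin n) (Fin n) ℝ) (f : Fin n → ℝ) :
    ∃ C, 0 ≤ C ∧ ∀ t i k ω, |centered A R f t i k ω| ≤ C := by
  refine ⟨∑ j, ∑ i, |natPairing f (X j i) - (A *ᵥ f) i|, Finset.sum_nonneg fun j _ =>
    Finset.sum_nonneg fun i _ => abs_nonneg _, fun t i k ω => ?_⟩
  obtain ⟨j, hj⟩ := hR.exists_eq_row t i k ω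
  rw [centered, hj]
  exact (Finset.single_le_sum (f := fun i => |natPairing f (X j i) - (A *ᵥ f) i|)
    (fun _ _ => abs_nonneg _) (Finset.mem_univ i)).trans
      (Finset.single_le_sum (f := fun j => ∑ i, |natPairing f (X j i) - (A *ᵥ f) i|)
        (fun _ _ => Finset.sum_nonneg fun _ _ => abs_nonneg _) (Finset.mem_univ j))

lemma integral_replacementLaw (hp : ∀ j, 0 < p j) (i : Fin n) (g : (Fin n → ℕ) → ℝ) :
    ∫ r, g r ∂replacementLaw X p i = ∑ j, p j * g (X j i) := by
  rw [replacementLaw, integral_finsetSum_measure]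
  · refine Finset.sum_congr rfl fun j _ => ?_
    rw [integral_smul_measure, integral_dirac, ENNReal.toReal_ofReal (hp j).le, smul_eq_mul]
  · exact fun j _ => (integrable_dirac (by simp)).smul_measure ENNReal.ofReal_ne_top

lemma integral_centered [IsProbabilityMeasure P] (hR : IsRegularReplacementFamily P X p R)
    (hp : ∀ j, 0 < p j) (hp_sum : ∑ j, p j = 1) (f : Fin n → ℝ) (t : ℕ) (i : Fin n) (k : ℕ) :
    ∫ ω, centered (meanMatrix X p) R f t i k ω ∂P = 0 := by
  have h := (hR.hasLaw t i k).integral_comp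
    (f := fun r => natPairing f r - (meanMatrix X p *ᵥ f) i)
    (Measurable.of_discrete).aestronglyMeasurable
  refine (show ∫ ω, centered (meanMatrix X p) R f t i k ω ∂P = _ from h).trans ?_
  rw [integral_replacementLaw hp, meanMatrix_mulVec]
  simp only [mul_sub, Finset.sum_sub_distrib, ← Finset.sum_mul, hp_sum, one_mul]
  exact sub_self _

section Sums

variable (q : Finset (Σ _ : Fin n, ℕ))

omit mΩ in
lemma abs_sum_centered_le {A : Matrix (Fin n) (Fin n) ℝ} {f : Fin n → ℝ} {C : ℝ}
    (hC : ∀ t i k ω, |centered A R f t i k ω| ≤ C) (t : ℕ) (ω : Ω) :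
    |∑ a ∈ q, centered A R f t a.1 a.2 ω| ≤ q.card * C := by
  refine (Finset.abs_sum_le_sum_abs _ _).trans ?_
  rw [← nsmul_eq_mul]
  exact Finset.sum_le_card_nsmul _ _ _ fun a _ => hC t a.1 a.2 ω

variable [IsProbabilityMeasure P] (hR : IsRegularReplacementFamily P X p R)
  (hp : ∀ j, 0 < p j) (hp_sum : ∑ j, p j = 1) {f : Fin n → ℝ} {C : ℝ}
  (hC : ∀ t i k ω, |centered (meanMatrix X p) R f t i k ω| ≤ C) (t : ℕ)

include hR hC

lemma memLp_centered (i : Fin n) (k : ℕ) : MemLp (centered (meanMatrix X p) R f t i k) 2 P :=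
  MemLp.of_bound ((measurable_centered _ f t i k).mono (hR.stepSigma_le t) le_rfl).aestronglyMeasurable
    C (ae_of_all _ fun ω => hC t i k ω)

include hp hp_sum

lemma integral_sum_centered :
    ∫ ω, ∑ a ∈ q, centered (meanMatrix X p) R f t a.1 a.2 ω ∂P = 0 := by
  rw [integral_finsetSum _ fun a _ => (hR.memLp_centered hC t a.1 a.2).integrable (by norm_num)]
  exact Finset.sum_eq_zero fun a _ => hR.integral_centered hp hp_sum f t a.1 a.2

/-- Pairwise independence removes the covariances, so the bound is linear, not quadratic, in the
number of terms. -/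
lemma integral_sum_centered_sq_le :
    ∫ ω, (∑ a ∈ q, centered (meanMatrix X p) R f t a.1 a.2 ω) ^ 2 ∂P ≤ q.card * C ^ 2 := by
  have hmeas : ∀ i k, Measurable (centered (meanMatrix X p) R f t i k) := fun i k =>
    (measurable_centered _ f t i k).mono (hR.stepSigma_le t) le_rfl
  have hvar : Var[∑ a ∈ q, centered (meanMatrix X p) R f t a.1 a.2; P] =
      ∑ a ∈ q, Var[centered (meanMatrix X p) R f t a.1 a.2; P] := by
    refine IndepFun.variance_sum (fun a _ => hR.memLp_centered hC t a.1 a.2) fun a _ b _ hab => ?_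
    have h := hR.indep
    have h1 : IndepFun (R t a.1 a.2) (R t b.1 b.2) P :=
      h.indepFun (i := (t, a.1, a.2)) (j := (t, b.1, b.2)) fun heq => hab (by
        simp only [Prod.mk.injEq, true_and] at heq
        exact Sigma.ext heq.1 (heq_of_eq heq.2))
    exact h1.comp (φ := fun r => natPairing f r - (meanMatrix X p *ᵥ f) a.1)
      (ψ := fun r => natPairing f r - (meanMatrix X p *ᵥ f) b.1)
      Measurable.of_discrete Measurable.of_discrete
  have hsum_meas : Measurable (∑ a ∈ q, centered (meanMatrix X p) R f t a.1 a.2) := by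
    simpa only [← Finset.sum_apply] using Finset.measurable_fun_sum q fun a _ => hmeas a.1 a.2
  rw [variance_of_integral_eq_zero hsum_meas.aemeasurable
    (by simpa only [Finset.sum_apply] using hR.integral_sum_centered q hp hp_sum hC t)] at hvar
  simp only [Finset.sum_apply] at hvar
  rw [hvar, ← nsmul_eq_mul]
  refine Finset.sum_le_card_nsmul _ _ _ fun a _ => ?_
  rw [variance_of_integral_eq_zero (hmeas a.1 a.2).aemeasurable
    (hR.integral_centered hp hp_sum f t a.1 a.2)]
  calc ∫ ω, centered (meanMatrix X p) R f t a.1 a.2 ω ^ 2 ∂P ≤ ∫ _, C ^ 2 ∂P := by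
        refine integral_mono_of_nonneg (ae_of_all _ fun ω => sq_nonneg _) (integrable_const _)
          (ae_of_all _ fun ω => ?_)
        exact sq_le_sq' (abs_le.1 (hC t a.1 a.2 ω)).1 (abs_le.1 (hC t a.1 a.2 ω)).2
    _ = C ^ 2 := by simp

end Sums

lemma exists_natPairing_bound (hR : IsRegularReplacementFamily P X p R) (α₀ : Fin n → ℕ)
    (f : Fin n → ℝ) (t : ℕ) : ∃ B, ∀ ω, |natPairing f (substitutionVector R α₀ t ω)| ≤ B := by
  obtain ⟨N, hN⟩ := hR.exists_bound α₀ t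
  refine ⟨∑ l, N * |f l|, fun ω => ?_⟩
  rw [natPairing, dotProduct]
  refine (Finset.abs_sum_le_sum_abs _ _).trans (Finset.sum_le_sum fun l _ => ?_)
  rw [abs_mul, abs_of_nonneg (Nat.cast_nonneg _)]
  exact mul_le_mul_of_nonneg_right (by exact_mod_cast hN ω l) (abs_nonneg _)

omit mΩ in
lemma measurable_natPairing_substitutionVector (α₀ : Fin n → ℕ) (f : Fin n → ℝ) (t : ℕ) :
    Measurable[pastSigma R t] fun ω => natPairing f (substitutionVector R α₀ t ω) :=
  (measurable_natPairing f).comp (measurable_substitutionVector α₀ t)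

lemma integrable_mul_natPairing [IsFiniteMeasure P] (hR : IsRegularReplacementFamily P X p R)
    (α₀ : Fin n → ℕ) (f : Fin n → ℝ) (t : ℕ) {H : Ω → ℝ} (hH : Measurable H) {D : ℝ}
    (hD : ∀ ω, |H ω| ≤ D) :
    Integrable (fun ω => H ω * natPairing f (substitutionVector R α₀ t ω)) P := by
  obtain ⟨B, hB⟩ := hR.exists_natPairing_bound α₀ f t
  refine Integrable.of_bound (hH.mul ((measurable_natPairing_substitutionVector α₀ f t).mono
    (hR.pastSigma_le t) le_rfl)).aestronglyMeasurable (D * B) (ae_of_all _ fun ω => ?_)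
  rw [Real.norm_eq_abs, abs_mul]
  exact mul_le_mul (hD ω) (hB ω) (abs_nonneg _) ((abs_nonneg _).trans (hD ω))

lemma measurable_noise (hR : IsRegularReplacementFamily P X p R) (A : Matrix (Fin n) (Fin n) ℝ)
    (α₀ : Fin n → ℕ) (f : Fin n → ℝ) (t : ℕ) : Measurable (noise A R α₀ f t) :=
  ((measurable_natPairing_substitutionVector α₀ f (t + 1)).mono (hR.pastSigma_le _) le_rfl).sub
    ((measurable_natPairing_substitutionVector α₀ _ t).mono (hR.pastSigma_le _) le_rfl)

lemma exists_noise_bound (hR : IsRegularReplacementFamily P X p R) (A : Matrix (Fin n) (Fin n) ℝ)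
    (α₀ : Fin n → ℕ) (f : Fin n → ℝ) (t : ℕ) : ∃ B, ∀ ω, |noise A R α₀ f t ω| ≤ B := by
  obtain ⟨B, hB⟩ := hR.exists_natPairing_bound α₀ f (t + 1)
  obtain ⟨B', hB'⟩ := hR.exists_natPairing_bound α₀ (A *ᵥ f) t
  exact ⟨B + B', fun ω => (abs_sub _ _).trans (add_le_add (hB ω) (hB' ω))⟩

variable [IsProbabilityMeasure P]

/-- The noise has conditional mean zero. -/
lemma integral_mul_noise (hR : IsRegularReplacementFamily P X p R) (hp : ∀ j, 0 < p j)
    (hp_sum : ∑ j, p j = 1) (α₀ : Fin n → ℕ) (f : Fin n → ℝ) (t : ℕ) {H : Ω → ℝ}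
    (hH : Measurable[pastSigma R t] H) {D : ℝ} (hD : ∀ ω, |H ω| ≤ D) :
    ∫ ω, H ω * noise (meanMatrix X p) R α₀ f t ω ∂P = 0 := by
  obtain ⟨C, hC0, hC⟩ := hR.exists_centered_bound (meanMatrix X p) f
  obtain ⟨N, hN⟩ := hR.exists_bound α₀ t
  simp only [noise_eq]
  rw [integral_mul_eval_eq (hR.pastSigma_le t) (hR.stepSigma_le t) (hR.indep_pastSigma_stepSigma t)
    (measurable_substitutionVector α₀ t) (F := Fintype.piFinset fun _ => Finset.range (N + 1))
    (fun ω => Fintype.mem_piFinset.2 fun l => Finset.mem_range.2 (Nat.lt_succ_of_le (hN ω l)))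
    hH hD (Φ := fun x ω => ∑ q ∈ Finset.univ.sigma fun i => Finset.range (x i),
        centered (meanMatrix X p) R f t q.1 q.2 ω)
    (fun x => Finset.measurable_fun_sum _ fun a _ => measurable_centered _ f t a.1 a.2)
    (fun x ω => abs_sum_centered_le _ hC t ω)]
  simp only [hR.integral_sum_centered _ hp hp_sum hC t, mul_zero, integral_zero]

/-- The conditional second moment of the noise is at most linear in the population. -/
lemma exists_integral_mul_noise_sq_le (hR : IsRegularReplacementFamily P X p R) (hp : ∀ j, 0 < p j)
    (hp_sum : ∑ j, p j = 1) (α₀ : Fin n → ℕ) (f : Fin n → ℝ) :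
    ∃ C : ℝ, 0 ≤ C ∧ ∀ (t : ℕ) (H : Ω → ℝ) (D : ℝ), Measurable[pastSigma R t] H →
      (∀ ω, 0 ≤ H ω) → (∀ ω, H ω ≤ D) →
      ∫ ω, H ω * noise (meanMatrix X p) R α₀ f t ω ^ 2 ∂P ≤
        C * ∫ ω, H ω * natPairing 1 (substitutionVector R α₀ t ω) ∂P := by
  obtain ⟨C, hC0, hC⟩ := hR.exists_centered_bound (meanMatrix X p) f
  refine ⟨C ^ 2, sq_nonneg C, fun t H D hH hH0 hHD => ?_⟩
  have hD : ∀ ω, |H ω| ≤ D := fun ω => (abs_of_nonneg (hH0 ω)).trans_le (hHD ω)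
  obtain ⟨N, hN⟩ := hR.exists_bound α₀ t
  simp only [noise_eq]
  rw [integral_mul_eval_eq (hR.pastSigma_le t) (hR.stepSigma_le t) (hR.indep_pastSigma_stepSigma t)
    (measurable_substitutionVector α₀ t) (F := Fintype.piFinset fun _ => Finset.range (N + 1))
    (fun ω => Fintype.mem_piFinset.2 fun l => Finset.mem_range.2 (Nat.lt_succ_of_le (hN ω l)))
    hH hD (Φ := fun x ω => (∑ q ∈ Finset.univ.sigma fun i => Finset.range (x i),
        centered (meanMatrix X p) R f t q.1 q.2 ω) ^ 2)
    (fun x => (Finset.measurable_fun_sum _ fun a _ =>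
      measurable_centered _ f t a.1 a.2).pow_const 2)
    (fun x ω => by
      rw [abs_pow]
      exact pow_le_pow_left₀ (abs_nonneg _) (abs_sum_centered_le _ hC t ω) 2),
    ← integral_const_mul]
  refine integral_mono_of_nonneg (ae_of_all _ fun ω => mul_nonneg (hH0 ω)
    (integral_nonneg fun ω => sq_nonneg _))
    ((hR.integrable_mul_natPairing α₀ 1 t (hH.mono (hR.pastSigma_le t) le_rfl) hD).const_mul _)
    (ae_of_all _ fun ω => ?_)
  have h := hR.integral_sum_centered_sq_le (Finset.univ.sigma fun i => Finset.range
    (substitutionVector R α₀ t ω i)) hp hp_sum hC t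
  have hcard : ((Finset.univ.sigma fun i => Finset.range (substitutionVector R α₀ t ω i)).card : ℝ)
      = natPairing 1 (substitutionVector R α₀ t ω) := by
    simp [natPairing, dotProduct]
  rw [hcard] at h
  calc _ ≤ H ω * (natPairing 1 (substitutionVector R α₀ t ω) * C ^ 2) :=
        mul_le_mul_of_nonneg_left h (hH0 ω)
    _ = _ := by ring

end IsRegularReplacementFamily

end Noise

/-! ### Almost sure summability, Fatou, and a zero-one law. -/

section MeasureLemmas

variable {Ω : Type*} [mΩ : MeasurableSpace Ω] {P : Measure Ω}

/-- By Tonelli the sum has finite integral, hence is finite almost everywhere. -/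
lemma ae_summable_of_summable_integral {f : ℕ → Ω → ℝ} (hf : ∀ t, Integrable (f t) P)
    (hf0 : ∀ t ω, 0 ≤ f t ω) (hsum : Summable fun t => ∫ ω, f t ω ∂P) :
    ∀ᵐ ω ∂P, Summable fun t => f t ω := by
  have hmeas : ∀ t, AEMeasurable (fun ω => ENNReal.ofReal (f t ω)) P := fun t =>
    (hf t).aestronglyMeasurable.aemeasurable.ennreal_ofReal
  have h : ∫⁻ ω, ∑' t, ENNReal.ofReal (f t ω) ∂P ≠ ⊤ := by
    rw [lintegral_tsum hmeas]
    simp_rw [← fun t => ofReal_integral_eq_lintegral_ofReal (hf t) (ae_of_all P (hf0 t))]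
    exact hsum.tsum_ofReal_ne_top
  filter_upwards [ae_lt_top' (AEMeasurable.tsum hmeas) h] with ω hω
  have := ENNReal.summable_toReal hω.ne
  simpa only [ENNReal.toReal_ofReal (hf0 _ ω)] using this

/-- Fatou's lemma for a sequence of functions converging to a constant on a set. -/
lemma mul_measureReal_le_of_tendsto [IsFiniteMeasure P] {g : ℕ → Ω → ℝ}
    (hgm : ∀ s, Measurable (g s)) (hg : ∀ s, Integrable (g s) P) (hg0 : ∀ s ω, 0 ≤ g s ω) {L : ℝ}
    (hL : ∀ s, ∫ ω, g s ω ∂P ≤ L) {S : Set Ω} (hS : MeasurableSet S) {β : ℝ} (hβ : 0 ≤ β)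
    (hlim : ∀ ω ∈ S, Tendsto (fun s => g s ω) atTop (𝓝 β)) : β * P.real S ≤ L := by
  have hL0 : 0 ≤ L := (integral_nonneg (hg0 0)).trans (hL 0)
  have h : ENNReal.ofReal β * P S ≤ ENNReal.ofReal L :=
    calc ENNReal.ofReal β * P S = ∫⁻ ω, S.indicator (fun _ => ENNReal.ofReal β) ω ∂P := by
          rw [lintegral_indicator_const hS]
      _ ≤ ∫⁻ ω, liminf (fun s => ENNReal.ofReal (g s ω)) atTop ∂P := by
          refine lintegral_mono fun ω => ?_
          by_cases hω : ω ∈ S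
          swap
          · simp [hω]
          rw [Set.indicator_of_mem hω]
          exact (((ENNReal.continuous_ofReal.tendsto β).comp (hlim ω hω)).liminf_eq).ge
      _ ≤ liminf (fun s => ∫⁻ ω, ENNReal.ofReal (g s ω) ∂P) atTop :=
          lintegral_liminf_le fun s => (hgm s).ennreal_ofReal
      _ ≤ ENNReal.ofReal L := by
          refine liminf_le_of_le (by isBoundedDefault) fun b hb => ?_
          obtain ⟨s, hs⟩ := hb.exists
          refine hs.trans ?_
          rw [← ofReal_integral_eq_lintegral_ofReal (hg s) (ae_of_all P (hg0 s))]
          exact ENNReal.ofReal_le_ofReal (hL s)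
  have := ENNReal.toReal_mono ENNReal.ofReal_ne_top h
  rwa [ENNReal.toReal_mul, ENNReal.toReal_ofReal hβ, ENNReal.toReal_ofReal hL0] at this

/-- If the conditional probabilities of a tail event along a filtration are bounded away from `1`
then the event is null. -/
lemma measure_eq_zero_of_forall_inter_le [IsProbabilityMeasure P] (ℱ : Filtration ℕ mΩ) {B : Set Ω}
    (hB : MeasurableSet[⨆ t, ℱ t] B) {c : ℝ} (hc : c < 1)
    (h : ∀ t E, MeasurableSet[ℱ t] E → P.real (B ∩ E) ≤ c * P.real E) : P B = 0 := by
  have hle : ⨆ t, ℱ t ≤ mΩ := iSup_le fun t => ℱ.le t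
  have hBm : MeasurableSet B := hle _ hB
  let g : Ω → ℝ := B.indicator fun _ => 1
  have hg : Integrable g P := (integrable_const 1).indicator hBm
  have hgm : StronglyMeasurable[⨆ t, ℱ t] g := stronglyMeasurable_const.indicator hB
  have hlim := hg.tendsto_ae_condExp (ℱ := ℱ) hgm
  obtain ⟨c', hcc', hc'⟩ := exists_between hc
  have hbound : ∀ t, ∀ᵐ ω ∂P, (P[g | ℱ t]) ω ≤ c' := by
    intro t
    -- On this event of the past, `c' * P(E) ≤ P(B ∩ E) ≤ c * P(E)` with `c < c'`, so `E` is null.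
    -- Thus the conditional probabilities of `B` stay below `c' < 1`, whereas by Lévy's theorem they
    -- tend to `1` almost surely on `B`.
    let E : Set Ω := {ω | c' < (P[g | ℱ t]) ω}
    have hE : MeasurableSet[ℱ t] E :=
      stronglyMeasurable_condExp.measurable measurableSet_Ioi
    have hEm : MeasurableSet E := ℱ.le t _ hE
    have h1 : c' * P.real E ≤ P.real (B ∩ E) := by
      calc c' * P.real E ≤ ∫ ω in E, (P[g | ℱ t]) ω ∂P :=
            setIntegral_ge_of_const_le_real hEm (measure_ne_top _ _) (fun ω hω => le_of_lt hω)
              integrable_condExp.integrableOn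
        _ = ∫ ω in E, g ω ∂P := setIntegral_condExp (ℱ.le t) hg hE
        _ = P.real (B ∩ E) := by
            simp only [g]
            rw [integral_indicator hBm, Measure.restrict_restrict hBm]
            simp
    have h2 : P.real E = 0 := by
      have := h t E hE
      have h3 : 0 ≤ P.real E := measureReal_nonneg
      nlinarith
    rw [measureReal_eq_zero_iff] at h2
    filter_upwards [measure_eq_zero_iff_ae_notMem.1 h2] with ω hω
    exact not_lt.1 hω
  rw [measure_eq_zero_iff_ae_notMem]
  filter_upwards [hlim, ae_all_iff.2 hbound] with ω h1 h2 hω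
  have := le_of_tendsto' h1 h2
  simp only [g, Set.indicator_of_mem hω] at this
  linarith

end MeasureLemmas

/-! ### Growth of the population and summability of the normalized noise. -/

section Growth

open Matrix

variable {Ω : Type*} [mΩ : MeasurableSpace Ω] {P : Measure Ω} {n m : ℕ}
  {X : Fin m → Matrix (Fin n) (Fin n) ℕ} {p : Fin m → ℝ} {R : ℕ → Fin n → ℕ → Ω → (Fin n → ℕ)}

lemma natPairing_smul (r : ℝ) (f : Fin n → ℝ) (x : Fin n → ℕ) :
    natPairing (r • f) x = r * natPairing f x := by
  rw [natPairing, dotProduct_smul, smul_eq_mul, natPairing]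

lemma natPairing_one (x : Fin n → ℕ) : natPairing 1 x = ((∑ l, x l : ℕ) : ℝ) := by
  simp [natPairing, dotProduct]

lemma mul_natPairing_one_le {δ : ℝ} {v : Fin n → ℝ} (hδv : ∀ i, δ ≤ v i) (x : Fin n → ℕ) :
    δ * natPairing 1 x ≤ natPairing v x := by
  simp only [natPairing, dotProduct, Finset.mul_sum]
  refine Finset.sum_le_sum fun l _ => ?_
  have := mul_le_mul_of_nonneg_right (hδv l) (Nat.cast_nonneg (α := ℝ) (x l))
  simp only [Pi.one_apply]
  linarith

namespace IsRegularReplacementFamily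

lemma sum_substitutionVector_pos (hR : IsRegularReplacementFamily P X p R)
    (hX : ∀ j i, 1 ≤ ∑ l, X j i l) {α₀ : Fin n → ℕ} (hα₀ : α₀ ≠ 0) (t : ℕ) (ω : Ω) :
    1 ≤ ∑ l, substitutionVector R α₀ t ω l := by
  induction t with
  | zero =>
    obtain ⟨i, hi⟩ := Function.ne_iff.1 hα₀
    exact (Nat.one_le_iff_ne_zero.2 hi).trans
      (Finset.single_le_sum (f := fun l => α₀ l) (fun _ _ => Nat.zero_le _) (Finset.mem_univ i))
  | succ t ih =>
    refine ih.trans ?_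
    simp only [substitutionVector, substitute, Finset.sum_apply]
    rw [Finset.sum_comm]
    refine Finset.sum_le_sum fun i _ => ?_
    rw [Finset.sum_comm]
    refine le_trans (le_of_eq (by simp)) (Finset.sum_le_sum (f := fun _ => 1) fun k _ => ?_)
    obtain ⟨j, hj⟩ := hR.exists_eq_row t i k ω
    simpa only [hj] using hX j i

lemma sum_substitutionVector_eq (hR : IsRegularReplacementFamily P X p R)
    (hX : ∀ j i, ∑ l, X j i l = 1) (α₀ : Fin n → ℕ) (t : ℕ) (ω : Ω) :
    ∑ l, substitutionVector R α₀ t ω l = ∑ l, α₀ l := by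
  induction t with
  | zero => rfl
  | succ t ih =>
    rw [← ih]
    simp only [substitutionVector, substitute, Finset.sum_apply]
    rw [Finset.sum_comm]
    refine Finset.sum_congr rfl fun i _ => ?_
    rw [Finset.sum_comm, Finset.sum_congr rfl (g := fun _ => 1) fun k _ => ?_]
    · simp
    · obtain ⟨j, hj⟩ := hR.exists_eq_row t i k ω
      simpa only [hj] using hX j i

variable [IsProbabilityMeasure P] (hR : IsRegularReplacementFamily P X p R) (hp : ∀ j, 0 < p j)
  (hp_sum : ∑ j, p j = 1) {r : ℝ} {v : Fin n → ℝ} (hv : meanMatrix X p *ᵥ v = r • v)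
  (α₀ : Fin n → ℕ)

omit mΩ in
include hv in
-- Since `v` is an eigenvector, dividing by `r ^ (t + 1)` exhibits a martingale whose increments are
-- the normalized noise.
lemma natPairing_succ (t : ℕ) (ω : Ω) :
    natPairing v (substitutionVector R α₀ (t + 1) ω) =
      r * natPairing v (substitutionVector R α₀ t ω) + noise (meanMatrix X p) R α₀ v t ω := by
  rw [noise, hv, natPairing_smul]
  ring

include hR hp hp_sum

include hv in
/-- The weighted population grows by the factor `r` per step in conditional mean. -/
lemma integral_mul_natPairing_add (t s : ℕ) {H : Ω → ℝ}
    (hH : Measurable[pastSigma R t] H) {D : ℝ} (hD : ∀ ω, |H ω| ≤ D) :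
    ∫ ω, H ω * natPairing v (substitutionVector R α₀ (t + s) ω) ∂P =
      r ^ s * ∫ ω, H ω * natPairing v (substitutionVector R α₀ t ω) ∂P := by
  induction s with
  | zero => simp
  | succ s ih =>
    have hH' : Measurable[pastSigma R (t + s)] H :=
      hH.mono (pastSigma_mono (Nat.le_add_right t s)) le_rfl
    have hHm : Measurable H := hH.mono (hR.pastSigma_le t) le_rfl
    have h1 := hR.integral_mul_noise hp hp_sum α₀ v (t + s) hH' hD
    simp only [noise, hv, mul_sub] at h1
    rw [integral_sub (hR.integrable_mul_natPairing α₀ _ _ hHm hD)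
      (hR.integrable_mul_natPairing α₀ _ _ hHm hD), sub_eq_zero] at h1
    rw [← add_assoc, h1, pow_succ', mul_assoc, ← ih, ← integral_const_mul]
    refine integral_congr_ae (ae_of_all _ fun ω => ?_)
    simp only [natPairing_smul]
    ring

include hv in
/-- The conditional second moment of the noise grows at most like `r ^ s`. -/
lemma exists_integral_mul_noise_sq_le_pow (hv0 : ∀ i, 0 < v i) (f : Fin n → ℝ) :
    ∃ C : ℝ, 0 ≤ C ∧ ∀ (t s : ℕ) (H : Ω → ℝ) (D : ℝ), Measurable[pastSigma R t] H →
      (∀ ω, 0 ≤ H ω) → (∀ ω, H ω ≤ D) →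
      ∫ ω, H ω * noise (meanMatrix X p) R α₀ f (t + s) ω ^ 2 ∂P ≤
        C * (r ^ s * ∫ ω, H ω * natPairing v (substitutionVector R α₀ t ω) ∂P) := by
  obtain ⟨δ, hδ, hδv⟩ := exists_pos_forall_le v hv0
  obtain ⟨C, hC0, hC⟩ := hR.exists_integral_mul_noise_sq_le hp hp_sum α₀ f
  refine ⟨C / δ, by positivity, fun t s H D hH hH0 hHD => ?_⟩
  have hD : ∀ ω, |H ω| ≤ D := fun ω => (abs_of_nonneg (hH0 ω)).trans_le (hHD ω)
  have hHm : Measurable H := hH.mono (hR.pastSigma_le t) le_rfl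
  refine (hC (t + s) H D (hH.mono (pastSigma_mono (Nat.le_add_right t s)) le_rfl) hH0 hHD).trans ?_
  rw [← hR.integral_mul_natPairing_add hp hp_sum hv α₀ t s hH hD, div_mul_eq_mul_div,
    le_div_iff₀ hδ, mul_assoc]
  refine mul_le_mul_of_nonneg_left ?_ hC0
  rw [← integral_mul_const]
  refine integral_mono ((hR.integrable_mul_natPairing α₀ _ _ hHm hD).mul_const _)
    (hR.integrable_mul_natPairing α₀ _ _ hHm hD) fun ω => ?_
  simp only
  rw [mul_assoc, mul_comm _ δ]
  exact mul_le_mul_of_nonneg_left (mul_natPairing_one_le hδv _) (hH0 ω)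

include hv in
/-- In the supercritical case the normalized noise is almost surely summable. -/
lemma ae_summable_noise (hv0 : ∀ i, 0 < v i) (hr : 1 < r) (f : Fin n → ℝ) :
    ∀ᵐ ω ∂P, Summable fun t => |noise (meanMatrix X p) R α₀ f t ω / r ^ (t + 1)| := by
  obtain ⟨C, hC0, hC⟩ := hR.exists_integral_mul_noise_sq_le_pow hp hp_sum hv α₀ hv0 f
  have hr0 : 0 < r := by linarith
  set σ := √r
  have hσ : σ ^ 2 = r := Real.sq_sqrt hr0.le
  have hσ0 : 0 < σ := Real.sqrt_pos.2 hr0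
  have hσ1 : 1 < σ := Real.lt_sqrt_of_sq_lt (by simpa using hr)
  have hgeom : Summable fun t : ℕ => (σ⁻¹) ^ t :=
    summable_geometric_of_lt_one (inv_nonneg.2 hσ0.le) (inv_lt_one_of_one_lt₀ hσ1)
  -- With `a = |noise| / r ^ t` and `σ = √r`, one has `a ≤ σ ^ t * a ^ 2 + σ⁻¹ ^ t`. The weight `σ ^
  -- t` balances the terms: since the noise has second moment `O(r ^ t)`, the first has mean `O(σ⁻¹
  -- ^ t)`.
  let g : ℕ → Ω → ℝ := fun t ω => σ ^ t / (r ^ t) ^ 2 * noise (meanMatrix X p) R α₀ f t ω ^ 2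
  have hg0 : ∀ t ω, 0 ≤ g t ω := fun t ω => by positivity
  have hg : ∀ t, Integrable (g t) P := by
    intro t
    obtain ⟨B, hB⟩ := hR.exists_noise_bound (meanMatrix X p) α₀ f t
    refine (Integrable.of_bound
      ((hR.measurable_noise (meanMatrix X p) α₀ f t).pow_const 2).aestronglyMeasurable (B ^ 2)
      (ae_of_all _ fun ω => ?_)).const_mul _
    rw [Real.norm_eq_abs, abs_pow]
    exact pow_le_pow_left₀ (abs_nonneg _) (hB ω) 2
  set K := C * ∫ ω, natPairing v (substitutionVector R α₀ 0 ω) ∂P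
  have hint : ∀ t, ∫ ω, g t ω ∂P ≤ K * (σ⁻¹) ^ t := by
    intro t
    have h := hC 0 t (fun _ => 1) 1 measurable_const (fun _ => zero_le_one) fun _ => le_rfl
    simp only [one_mul, zero_add] at h
    rw [integral_const_mul]
    refine (mul_le_mul_of_nonneg_left h (by positivity)).trans (le_of_eq ?_)
    simp only [K]
    rw [← hσ, inv_pow]
    field_simp
    ring
  have hsum : Summable fun t => ∫ ω, g t ω ∂P :=
    Summable.of_nonneg_of_le (fun t => integral_nonneg (hg0 t)) hint (hgeom.mul_left K)
  filter_upwards [ae_summable_of_summable_integral hg hg0 hsum] with ω hω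
  refine Summable.of_nonneg_of_le (fun t => abs_nonneg _) (fun t => ?_) (hω.add hgeom)
  have hrt : 0 < r ^ t := pow_pos hr0 t
  have hσt : 0 < σ ^ t := pow_pos hσ0 t
  set z := noise (meanMatrix X p) R α₀ f t ω
  have h1 : |z / r ^ (t + 1)| ≤ |z| / r ^ t := by
    rw [abs_div, abs_of_pos (pow_pos hr0 (t + 1))]
    exact div_le_div_of_nonneg_left (abs_nonneg _) hrt (pow_le_pow_right₀ hr.le (Nat.le_succ t))
  have h2 : |z| / r ^ t ≤ σ ^ t / (r ^ t) ^ 2 * z ^ 2 + (σ⁻¹) ^ t := by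
    set a := |z| / r ^ t
    have ha : σ ^ t / (r ^ t) ^ 2 * z ^ 2 = σ ^ t * a ^ 2 := by
      simp only [a, div_pow, sq_abs]
      ring
    have ha0 : 0 ≤ a := by positivity
    rw [ha, inv_pow, ← sub_nonneg]
    have : σ ^ t * a ^ 2 + (σ ^ t)⁻¹ - a = ((σ ^ t * a - 1) ^ 2 + σ ^ t * a) / σ ^ t := by
      field_simp
      ring
    rw [this]
    positivity
  exact h1.trans h2

end IsRegularReplacementFamily

end Growth

/-! ### Existence and positivity of the limit. -/

section Limit

open Matrix

variable {Ω : Type*} [mΩ : MeasurableSpace Ω] {P : Measure Ω} {n m : ℕ}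
  {X : Fin m → Matrix (Fin n) (Fin n) ℕ} {p : Fin m → ℝ} {R : ℕ → Fin n → ℕ → Ω → (Fin n → ℕ)}

lemma Matrix.IsPrimitive.smul {ι : Type*} [Fintype ι] [DecidableEq ι] {A : Matrix ι ι ℝ}
    (hA : A.IsPrimitive) {c : ℝ} (hc : 0 < c) : (c • A).IsPrimitive where
  nonneg i j := mul_nonneg hc.le (hA.nonneg i j)
  exists_pos_pow := by
    obtain ⟨k, hk, h⟩ := hA.exists_pos_pow
    refine ⟨k, hk, fun i j => ?_⟩
    rw [smul_pow]
    exact mul_pos (pow_pos hc k) (h i j)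

namespace IsRegularReplacementFamily

variable [IsProbabilityMeasure P] (hR : IsRegularReplacementFamily P X p R) (hp : ∀ j, 0 < p j)
  (hp_sum : ∑ j, p j = 1) {r : ℝ} {u v : Fin n → ℝ} (hv : meanMatrix X p *ᵥ v = r • v)
  (hv0 : ∀ i, 0 < v i) (hr : 1 < r) (α₀ : Fin n → ℕ)

include hR hp hp_sum hv hv0 hr

/-- Almost surely the normalized population vector converges to a multiple of the left Perron
eigenvector. -/
lemma ae_exists_tendsto [NeZero n] (hA : (meanMatrix X p).IsPrimitive) (hu0 : ∀ i, 0 < u i)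
    (hu : u ᵥ* meanMatrix X p = r • u) :
    ∀ᵐ ω ∂P, ∃ W : ℝ,
      Tendsto (fun t => natPairing v (substitutionVector R α₀ t ω) / r ^ t) atTop (𝓝 W) ∧
      Tendsto (fun t => substitutionProcess R α₀ t ω / r ^ t) atTop
        (𝓝 (W / (u ⬝ᵥ v) * ∑ i, u i)) := by
  have hr0 : 0 < r := by linarith
  filter_upwards [ae_all_iff.2 fun l =>
    hR.ae_summable_noise hp hp_sum hv α₀ hv0 hr (Pi.single l 1)] with ω hω
  obtain ⟨W, h1, h2⟩ := tendsto_of_perturbed_orbit (hA.smul (inv_pos.2 hr0)) hu0 hv0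
    (by rw [smul_mulVec, hv, inv_smul_smul₀ hr0.ne'])
    (by rw [vecMul_smul, hu, inv_smul_smul₀ hr0.ne'])
    (y := fun t => (r ^ t)⁻¹ • fun l => (substitutionVector R α₀ t ω l : ℝ))
    (ε := fun t l => noise (meanMatrix X p) R α₀ (Pi.single l 1) t ω / r ^ (t + 1))
    (fun t => by
      ext l
      simp only [noise, natPairing, dotProduct_mulVec, dotProduct_single_one, Pi.add_apply,
        Pi.smul_apply, smul_vecMul, vecMul_smul, smul_eq_mul, pow_succ]
      field_simp
      ring)
    hω
  refine ⟨W, ?_, ?_⟩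
  · refine h1.congr fun t => ?_
    rw [smul_dotProduct, smul_eq_mul, natPairing, div_eq_inv_mul]
  · rw [Finset.mul_sum]
    refine (tendsto_finsetSum Finset.univ fun i _ => h2 i).congr fun t => ?_
    simp only [Pi.smul_apply, smul_eq_mul, ← Finset.mul_sum, substitutionProcess, div_eq_inv_mul]

/-- A second moment bound: given the past, the normalized population tends to `0` with probability
bounded away from `1`. -/
lemma exists_measureReal_tendsto_zero_inter_le (hX : ∀ j i, 1 ≤ ∑ l, X j i l) (hα₀ : α₀ ≠ 0) :
    ∃ c < 1, ∀ t E, MeasurableSet[pastSigma R t] E →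
      P.real ({ω | Tendsto (fun t => natPairing v (substitutionVector R α₀ t ω) / r ^ t) atTop (𝓝 0)}
        ∩ E) ≤ c * P.real E := by
  have hr0 : 0 < r := by linarith
  obtain ⟨δ, hδ, hδv⟩ := exists_pos_forall_le v hv0
  obtain ⟨C, hC0, hC⟩ := hR.exists_integral_mul_noise_sq_le_pow hp hp_sum hv α₀ hv0 v
  have hlow : ∀ t ω, δ ≤ natPairing v (substitutionVector R α₀ t ω) := by
    intro t ω
    refine le_trans ?_ (mul_natPairing_one_le hδv _)
    rw [natPairing_one]
    have : (1 : ℝ) ≤ ((∑ l, substitutionVector R α₀ t ω l : ℕ) : ℝ) := by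
      exact_mod_cast hR.sum_substitutionVector_pos hX hα₀ t ω
    nlinarith
  have hρ1 : r⁻¹ < 1 := inv_lt_one_of_one_lt₀ hr
  have hρ0 : 0 < r⁻¹ := inv_pos.2 hr0
  -- Relative to `Z 0 ^ 2`, the later martingale increments contribute conditional variance at most
  -- `K`. Centering at `b * Z 0` gives second moment at most `(b - 1) ^ 2 + K`, against `b ^ 2` in
  -- the limit on the event. The choice `b = 1 + K` minimizes the ratio, to `K / (1 + K) < 1`; the
  -- choice `b = 1` would only give `K`.
  set K : ℝ := C / δ * (1 - r⁻¹)⁻¹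
  have hK0 : 0 ≤ K := mul_nonneg (by positivity) (inv_nonneg.2 (by linarith))
  set b : ℝ := 1 + K
  have hb : 0 < b := by positivity
  refine ⟨K / (1 + K), (div_lt_one hb).2 (by linarith), fun t E hE => ?_⟩
  have hEm : MeasurableSet E := hR.pastSigma_le t _ hE
  let Z : ℕ → Ω → ℝ := fun s ω => natPairing v (substitutionVector R α₀ (t + s) ω) / r ^ s
  have hZmeas : ∀ s, Measurable[pastSigma R (t + s)] (Z s) := fun s =>
    (measurable_natPairing_substitutionVector α₀ v (t + s)).div_const _
  have hZm : ∀ s, Measurable (Z s) := fun s => (hZmeas s).mono (hR.pastSigma_le _) le_rfl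
  have hZbd : ∀ s, ∃ D, ∀ ω, |Z s ω| ≤ D := by
    intro s
    obtain ⟨D, hD⟩ := hR.exists_natPairing_bound α₀ v (t + s)
    refine ⟨D / r ^ s, fun ω => ?_⟩
    rw [abs_div, abs_of_pos (pow_pos hr0 s)]
    exact div_le_div_of_nonneg_right (hD ω) (pow_pos hr0 s).le
  have hZ0 : ∀ ω, δ ≤ Z 0 ω := fun ω => by simpa [Z] using hlow t ω
  have hZ0meas : Measurable[pastSigma R t] (Z 0) := hZmeas 0
  -- Dividing by `Z 0 ^ 2` makes the estimate uniform in the past; the weight is bounded because `Z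
  -- 0 ≥ δ`.
  let H : Ω → ℝ := E.indicator fun ω => (Z 0 ω ^ 2)⁻¹
  have hHmeas : Measurable[pastSigma R t] H :=
    Measurable.indicator (Measurable.inv (hZ0meas.pow_const 2)) hE
  have hHm : Measurable H := hHmeas.mono (hR.pastSigma_le t) le_rfl
  have hH0 : ∀ ω, 0 ≤ H ω := fun ω => Set.indicator_nonneg (fun ω _ => by positivity) ω
  have hHD : ∀ ω, H ω ≤ (δ ^ 2)⁻¹ := fun ω =>
    Set.indicator_le' (s := E) (g := fun _ => (δ ^ 2)⁻¹)
      (fun ω _ => inv_anti₀ (by positivity) (pow_le_pow_left₀ hδ.le (hZ0 ω) 2))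
      (fun _ _ => by positivity) ω
  have hHabs : ∀ ω, |H ω| ≤ (δ ^ 2)⁻¹ := fun ω => (abs_of_nonneg (hH0 ω)).trans_le (hHD ω)
  have hbdd_mul : ∀ {f g : Ω → ℝ}, (∃ D, ∀ ω, |f ω| ≤ D) → (∃ D, ∀ ω, |g ω| ≤ D) →
      ∃ D, ∀ ω, |f ω * g ω| ≤ D := by
    rintro f g ⟨D, hD⟩ ⟨D', hD'⟩
    refine ⟨D * D', fun ω => ?_⟩
    rw [abs_mul]
    exact mul_le_mul (hD ω) (hD' ω) (abs_nonneg _) ((abs_nonneg _).trans (hD ω))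
  have hint : ∀ {f : Ω → ℝ}, Measurable f → (∃ D, ∀ ω, |f ω| ≤ D) → Integrable f P := by
    rintro f hf ⟨D, hD⟩
    exact Integrable.of_bound hf.aestronglyMeasurable D (ae_of_all _ hD)
  let Y : ℕ → Ω → ℝ := fun s ω => Z s ω - b * Z 0 ω
  have hYm : ∀ s, Measurable (Y s) := fun s => (hZm s).sub ((hZm 0).const_mul b)
  have hYbd : ∀ s, ∃ D, ∀ ω, |Y s ω| ≤ D := by
    intro s
    obtain ⟨D, hD⟩ := hZbd s
    obtain ⟨D', hD'⟩ := hZbd 0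
    refine ⟨D + b * D', fun ω => (abs_sub _ _).trans (add_le_add (hD ω) ?_)⟩
    rw [abs_mul, abs_of_pos hb]
    exact mul_le_mul_of_nonneg_left (hD' ω) hb.le
  have hHbd : ∃ D, ∀ ω, |H ω| ≤ D := ⟨_, hHabs⟩
  let N : ℕ → Ω → ℝ := fun s ω => noise (meanMatrix X p) R α₀ v (t + s) ω
  have hNm : ∀ s, Measurable (N s) := fun s => hR.measurable_noise _ α₀ v (t + s)
  have hNbd : ∀ s, ∃ D, ∀ ω, |N s ω| ≤ D := fun s => hR.exists_noise_bound _ α₀ v (t + s)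
  have hYsucc : ∀ s ω, Y (s + 1) ω = Y s ω + N s ω / r ^ (s + 1) := by
    intro s ω
    simp only [Y, Z, N, ← add_assoc, natPairing_succ hv]
    rw [pow_succ]
    field_simp
    ring
  have hHY : ∀ s, Integrable (fun ω => H ω * Y s ω ^ 2) P := fun s =>
    hint (hHm.mul ((hYm s).pow_const 2))
      (hbdd_mul hHbd (by simpa only [sq] using hbdd_mul (hYbd s) (hYbd s)))
  have hHYN : ∀ s, Integrable (fun ω => H ω * Y s ω * N s ω) P := fun s =>
    hint ((hHm.mul (hYm s)).mul (hNm s)) (hbdd_mul (hbdd_mul hHbd (hYbd s)) (hNbd s))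
  have hHN : ∀ s, Integrable (fun ω => H ω * N s ω ^ 2) P := fun s =>
    hint (hHm.mul ((hNm s).pow_const 2))
      (hbdd_mul hHbd (by simpa only [sq] using hbdd_mul (hNbd s) (hNbd s)))
  have hcross : ∀ s, ∫ ω, H ω * Y s ω * N s ω ∂P = 0 := by
    intro s
    obtain ⟨D, hD⟩ := hbdd_mul hHbd (hYbd s)
    have hmono := pastSigma_mono (R := R) (Nat.le_add_right t s)
    exact hR.integral_mul_noise hp hp_sum α₀ v (t + s)
      ((hHmeas.mono hmono le_rfl).mul ((hZmeas s).sub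
        ((hZ0meas.mono hmono le_rfl).const_mul b))) hD
  have hHZ : ∫ ω, H ω * natPairing v (substitutionVector R α₀ t ω) ∂P ≤ P.real E / δ := by
    calc ∫ ω, H ω * natPairing v (substitutionVector R α₀ t ω) ∂P
        ≤ ∫ ω, E.indicator (fun _ => δ⁻¹) ω ∂P := by
          refine integral_mono (hR.integrable_mul_natPairing α₀ v t hHm hHabs)
            ((integrable_const _).indicator hEm) fun ω => ?_
          by_cases hω : ω ∈ E
          · have h1 : natPairing v (substitutionVector R α₀ t ω) = Z 0 ω := by simp [Z]
            have h2 : 0 < Z 0 ω := hδ.trans_le (hZ0 ω)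
            simp only [H, Set.indicator_of_mem hω, h1]
            calc (Z 0 ω ^ 2)⁻¹ * Z 0 ω = (Z 0 ω)⁻¹ := by field_simp
              _ ≤ δ⁻¹ := inv_anti₀ hδ (hZ0 ω)
          · simp [H, hω]
      _ = P.real E / δ := by
          rw [integral_indicator_const _ hEm, smul_eq_mul, div_eq_mul_inv]
  -- The cross term vanishes, as `H * Y s` belongs to the past of the noise. The remaining variance
  -- is geometric in `s`, with sum at most `K * P.real E`.
  have hstep : ∀ s, ∫ ω, H ω * Y (s + 1) ω ^ 2 ∂P ≤
      ∫ ω, H ω * Y s ω ^ 2 ∂P + C / δ * P.real E * r⁻¹ ^ s := by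
    intro s
    have h1 : ∀ ω, H ω * Y (s + 1) ω ^ 2 = H ω * Y s ω ^ 2 +
        2 / r ^ (s + 1) * (H ω * Y s ω * N s ω) + (r ^ (s + 1))⁻¹ ^ 2 * (H ω * N s ω ^ 2) := by
      intro ω
      rw [hYsucc]
      ring
    have h0 : ∫ ω, H ω * Y (s + 1) ω ^ 2 ∂P = ∫ ω, H ω * Y s ω ^ 2 ∂P +
        (r ^ (s + 1))⁻¹ ^ 2 * ∫ ω, H ω * N s ω ^ 2 ∂P := by
      have hi₁ := (hHYN s).const_mul (2 / r ^ (s + 1))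
      have hi₂ : Integrable (fun ω => H ω * Y s ω ^ 2 +
          2 / r ^ (s + 1) * (H ω * Y s ω * N s ω)) P := (hHY s).add hi₁
      rw [integral_congr_ae (ae_of_all P h1), integral_add hi₂ ((hHN s).const_mul _),
        integral_add (hHY s) hi₁, integral_const_mul, integral_const_mul, hcross, mul_zero,
        add_zero]
    rw [h0]
    refine add_le_add_right ?_ _
    have h2 := (hC t s H _ hHmeas hH0 hHD).trans
      (mul_le_mul_of_nonneg_left (mul_le_mul_of_nonneg_left hHZ (pow_pos hr0 s).le) hC0)
    have h3 : (r ^ (s + 1))⁻¹ ^ 2 * (C * (r ^ s * (P.real E / δ))) =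
        C / δ * P.real E * r⁻¹ ^ s * (r⁻¹ ^ 2) := by
      rw [pow_succ, inv_pow, inv_pow]
      field_simp
      ring
    refine (mul_le_mul_of_nonneg_left h2 (by positivity)).trans (h3.le.trans ?_)
    exact mul_le_of_le_one_right (by positivity) (pow_le_one₀ hρ0.le hρ1.le)
  have hsq : ∀ ω ∈ E, ∀ a : ℝ, H ω * (a * Z 0 ω) ^ 2 = a ^ 2 := by
    intro ω hω a
    have h2 : 0 < Z 0 ω := hδ.trans_le (hZ0 ω)
    simp only [H, Set.indicator_of_mem hω]
    field_simp
  have hzero : ∫ ω, H ω * Y 0 ω ^ 2 ∂P = K ^ 2 * P.real E := by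
    have h1 : ∀ ω, H ω * Y 0 ω ^ 2 = E.indicator (fun _ => K ^ 2) ω := by
      intro ω
      by_cases hω : ω ∈ E
      · rw [Set.indicator_of_mem hω, ← neg_sq K, ← hsq ω hω (-K)]
        simp only [Y, b]
        ring
      · simp [H, hω]
    rw [integral_congr_ae (ae_of_all P h1), integral_indicator_const _ hEm, smul_eq_mul, mul_comm]
  have hbound : ∀ s, ∫ ω, H ω * Y s ω ^ 2 ∂P ≤ (K ^ 2 + K) * P.real E := by
    intro s
    have h1 : ∫ ω, H ω * Y s ω ^ 2 ∂P ≤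
        K ^ 2 * P.real E + C / δ * P.real E * ∑ i ∈ Finset.range s, r⁻¹ ^ i := by
      induction s with
      | zero => simp [hzero]
      | succ s ih =>
        rw [Finset.sum_range_succ, mul_add]
        linarith [hstep s]
    have h2 : ∑ i ∈ Finset.range s, r⁻¹ ^ i ≤ (1 - r⁻¹)⁻¹ := by
      rw [← tsum_geometric_of_lt_one hρ0.le hρ1]
      exact (summable_geometric_of_lt_one hρ0.le hρ1).sum_le_tsum _ fun i _ => by positivity
    have h3 : C / δ * P.real E * ∑ i ∈ Finset.range s, r⁻¹ ^ i ≤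
        C / δ * P.real E * (1 - r⁻¹)⁻¹ :=
      mul_le_mul_of_nonneg_left h2 (mul_nonneg (by positivity) measureReal_nonneg)
    have h4 : C / δ * P.real E * (1 - r⁻¹)⁻¹ = K * P.real E := by
      simp only [K]
      ring
    linarith
  set S := {ω | Tendsto (fun t => natPairing v (substitutionVector R α₀ t ω) / r ^ t) atTop (𝓝 0)}
  have hS : MeasurableSet S := measurableSet_tendsto _ fun t =>
    ((measurable_natPairing_substitutionVector α₀ v t).mono (hR.pastSigma_le t) le_rfl).div_const _
  -- On `S ∩ E`, `Z s` tends to `0`, so the integrand tends to `b ^ 2`.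
  have hfatou := mul_measureReal_le_of_tendsto (β := b ^ 2)
    (fun s => hHm.mul ((hYm s).pow_const 2)) hHY
    (fun s ω => mul_nonneg (hH0 ω) (sq_nonneg _)) hbound (hS.inter hEm) (sq_nonneg b)
    fun ω hω => by
      have hZlim : Tendsto (fun s => Z s ω) atTop (𝓝 0) := by
        have h1 : Tendsto (fun s => natPairing v (substitutionVector R α₀ (s + t) ω) / r ^ (s + t))
          atTop (𝓝 0) := (tendsto_add_atTop_iff_nat t).2 hω.1
        have h2 := h1.mul_const (r ^ t)
        rw [zero_mul] at h2
        refine h2.congr fun s => ?_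
        simp only [Z, add_comm t s, pow_add]
        field_simp
      have h2 : Tendsto (fun s => H ω * Y s ω ^ 2) atTop (𝓝 (H ω * (0 - b * Z 0 ω) ^ 2)) :=
        ((hZlim.sub_const _).pow 2).const_mul _
      have h3 : H ω * (0 - b * Z 0 ω) ^ 2 = b ^ 2 := by
        rw [zero_sub, neg_sq, hsq ω hω.2]
      rwa [h3] at h2
  have h5 : b ^ 2 * P.real (S ∩ E) ≤ b * (K * P.real E) :=
    hfatou.trans (le_of_eq (by simp only [b]; ring))
  rw [sq, mul_assoc] at h5
  rw [div_mul_eq_mul_div, le_div_iff₀ hb, mul_comm]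
  exact le_of_mul_le_mul_left h5 hb

/-- Almost surely the normalized population does not tend to `0`. -/
lemma ae_not_tendsto_zero (hX : ∀ j i, 1 ≤ ∑ l, X j i l) (hα₀ : α₀ ≠ 0) :
    ∀ᵐ ω ∂P,
      ¬ Tendsto (fun t => natPairing v (substitutionVector R α₀ t ω) / r ^ t) atTop (𝓝 0) := by
  obtain ⟨c, hc, h⟩ :=
    hR.exists_measureReal_tendsto_zero_inter_le hp hp_sum hv hv0 hr α₀ hX hα₀
  refine measure_eq_zero_iff_ae_notMem.1
    (measure_eq_zero_of_forall_inter_le hR.filtration (c := c) ?_ hc h)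
  refine measurableSet_tendsto _ fun t => Measurable.div_const ?_ _
  exact (measurable_natPairing_substitutionVector α₀ v t).mono
    (le_iSup (fun t => hR.filtration t) t) le_rfl

end IsRegularReplacementFamily

end Limit

/-! ### The critical and supercritical cases. -/

theorem mainTheorem2 {Ω : Type*} [MeasurableSpace Ω] (P : Measure Ω) [IsProbabilityMeasure P]
    {n m : ℕ} (X : Fin m → Matrix (Fin n) (Fin n) ℕ) 
    (hX : ∀ j, ((X j).map (Nat.cast : ℕ → ℝ)).IsPrimitive)
    (p : Fin m → ℝ) (hp : ∀ j, 0 < p j) (hp_sum : ∑ j, p j = 1)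
    (α₀ : Fin n → ℕ) (hα₀ : α₀ ≠ 0)
    (R : ℕ → Fin n → ℕ → Ω → (Fin n → ℕ)) (hR : IsReplacementFamily P X p R)
    (hinv : IsUnit (meanMatrix X p)) :
    ∀ᵐ ω ∂P, AsympConst (fun t => substitutionProcess R α₀ t ω)
      (fun t => matrixSpectralRadius (meanMatrix X p) ^ t) := by
  obtain ⟨i₀, hi₀⟩ := Function.ne_iff.1 hα₀
  have : NeZero n := ⟨by rintro rfl; exact i₀.elim0⟩
  obtain ⟨j₀⟩ : Nonempty (Fin m) := by
    by_contra hcon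
    rw [not_nonempty_iff] at hcon
    simp at hp_sum
  have hA := meanMatrix_isPrimitive hX hp j₀
  obtain ⟨r, v, u, hr0, hv0, hu0, hv, hu⟩ := hA.exists_pos_eigenvectors
  rw [matrixSpectralRadius_eq hA.nonneg hr0 hv0 hv]
  have hrow : ∀ j i, 1 ≤ ∑ l, X j i l := fun j => one_le_row_sum (hX j)
  obtain ⟨hr1, hr_eq⟩ := one_le_eigenvalue hrow hp hp_sum hu0 hu
  obtain ⟨R', hR', hRR'⟩ := hR.exists_regular j₀
  -- For `r = 1` each individual is replaced by exactly one, so the process is constant and the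
  -- limit is the initial population.
  rcases hr1.eq_or_lt with h1 | hr
  · filter_upwards [hRR'] with ω hω
    refine ⟨((∑ l, α₀ l : ℕ) : ℝ), ?_, ?_⟩
    · exact_mod_cast hR'.sum_substitutionVector_pos hrow hα₀ 0 ω
    · refine tendsto_const_nhds.congr fun t => ?_
      simp only [← h1]
      rw [one_pow, div_one, substitutionProcess, substitutionVector_congr hω, ← Nat.cast_sum,
        hR'.sum_substitutionVector_eq (hr_eq h1.symm)]
  · filter_upwards [hRR', hR'.ae_exists_tendsto hp hp_sum hv hv0 hr α₀ hA hu0 hu,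
      hR'.ae_not_tendsto_zero hp hp_sum hv hv0 hr α₀ hrow hα₀] with ω hω hlim hne
    obtain ⟨W, hW, hproc⟩ := hlim
    have hW0 : 0 ≤ W := ge_of_tendsto' hW fun t =>
      div_nonneg (dotProduct_nonneg_of_nonneg (fun l => Nat.cast_nonneg _) fun l => (hv0 l).le)
        (pow_pos hr0 t).le
    have hWpos : 0 < W := lt_of_le_of_ne hW0 fun h => hne (h ▸ hW)
    refine ⟨_, mul_pos (div_pos hWpos (dotProduct_pos hu0 hv0))
      (Finset.sum_pos (fun i _ => hu0 i) Finset.univ_nonempty), hproc.congr fun t => ?_⟩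
    simp only [substitutionProcess, substitutionVector_congr hω]
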